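/- Let $\mathcal H$ be a separable complex Hilbert space and $\mathcal H_N=\mathcal H^{\otimes N}$ its $N$-fold Hilbert space tensor power. A density matrix on a Hilbert space is a positive operator of trace $1$. Let $h$ be a (possibly unbounded) self-adjoint operator on $\mathcal H$ that is bounded below and has compact resolvent, and let $H_N=\sum_{j=1}^N h_j$, where $h_j$ is $h$ acting on the $j$-th factor. A collision specification $(\mathcal C,U,\nu)$ consists of a compact metric space $\mathcal C$, a strongly continuous (in particular, possibly norm-continuous) injective map $U$ from $\mathcal C$ to the unitary operators on $\mathcal H_2$, and a Borel probability measure $\nu$ on $\mathcal C$ that charges all nonempty open sets, such that: (i) each $U(\sigma)$ commutes with $H_2$; (ii) $U(\sigma_0)=1$ for some $\sigma_0$; (iii) $\{U(\sigma)\}=\{U(\sigma)^*\}$, and the map $\sigma\mapsto\sigma'$ with $U(\sigma)^*=U(\sigma')$ is measurable and leaves $\nu$ invariant; (iv) with the swap $V(\phi\otimes\psi)=\psi\otimes\phi$, $\{U(\sigma)\}=\{VU(\sigma)V^*\}$, and the map $\sigma\mapsto\sigma'$ with $VU(\sigma)V^*=U(\sigma')$ is measurable and leaves $\nu$ invariant.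 It is ergodic if the commutant $\{U(\sigma):\sigma\in\mathcal C\}'$ equals the energy algebra $\mathcal A_2$ of all operators $f(H_2)$, $f$ bounded on the spectrum of $H_2$. For $N\ge 2$ and bounded operators $A$ on $\mathcal H_N$ let $$\mathcal Q_{i,j}A=\int_{\mathcal C}U_{i,j}(\sigma)\,A\,U_{i,j}(\sigma)^*\,d\nu(\sigma),\qquad \mathcal Q_N=\binom N2^{-1}\sum_{i<j}\mathcal Q_{i,j},\qquad \mathcal L_N=N(\mathcal Q_N-1),$$ where $U_{i,j}(\sigma)$ is $U(\sigma)$ acting on the $i$-th and $j$-th factors. The quantum Kac Master Equation is $\frac{d}{dt}\varrho=\mathcal L_N\varrho$, solved by $e^{t\mathcal L_N}\varrho_0$. A density matrix on $\mathcal H_N$ is a product state if it is $\rho_1\otimes\cdots\otimes\rho_N$ with density matrices $\rho_j$ on $\mathcal H$, and it is separable if it lies in the trace-norm closed convex hull of the product states. **Corollary.** Let $(\mathcal C,U,\nu)$ be an ergodic collision specification and $N\ge2$. Then every density matrix $\varrho$ on $\mathcal H_N$ with $\mathcal L_N\varrho=0$ is separable. Consequently the evolution destroys all entanglement in the long-time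 limit: for every density matrix $\varrho_0$ on $\mathcal H_N$ there is a separable density matrix $\varrho_\infty$ with $\mathcal L_N\varrho_\infty=0$ and $\lim_{t\to\infty}\|e^{t\mathcal L_N}\varrho_0-\varrho_\infty\|_1=0$, where $\|A\|_1=\mathrm{Tr}\,(A^*A)^{1/2}$. -/

import Mathlib

open scoped InnerProductSpace
open MeasureTheory Filter Topology

noncomputable section

namespace QuantumKac

section SquareSummable
variable {X Y Z : Type*}

/-- The Hilbert space of square-summable complex families indexed by `X`. -/
abbrev L2 (X : Type*) : Type _ := lp (fun _ : X => ℂ) 2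

theorem memL2_iff {f : X → ℂ} : Memℓp f 2 ↔ Summable fun x => ‖f x‖ ^ 2 := by
  rw [memℓp_gen_iff (by norm_num)]
  simp

theorem L2.summable (f : L2 X) : Summable fun x => ‖f x‖ ^ 2 := memL2_iff.1 f.2

theorem L2.norm_sq (f : L2 X) : ‖f‖ ^ 2 = ∑' x, ‖f x‖ ^ 2 := by
  have := lp.norm_rpow_eq_tsum (p := 2) (by norm_num) f
  simpa using this

theorem L2.inner_eq (f g : L2 X) : ⟪f, g⟫_ℂ = ∑' x, starRingEnd ℂ (f x) * g x := by
  rw [lp.inner_eq_tsum]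
  exact tsum_congr fun x => by rw [RCLike.inner_apply']

theorem L2.summable_norm_mul (f g : L2 X) : Summable fun x => ‖starRingEnd ℂ (f x) * g x‖ := by
  refine Summable.of_nonneg_of_le (fun x => norm_nonneg _) (fun x => ?_)
    ((L2.summable f).add (L2.summable g))
  rw [norm_mul, RCLike.norm_conj]
  nlinarith [sq_nonneg (‖f x‖ - ‖g x‖), sq_nonneg (‖f x‖), sq_nonneg (‖g x‖)]

/-- For an identification `Z ≃ X × Y`, the section `x ↦ f (x, y)` of a square-summable family. -/
def slice (e : Z ≃ X × Y) (y : Y) : L2 Z →ₗ[ℂ] L2 X where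
  toFun f := ⟨fun x => f (e.symm (x, y)), memL2_iff.2 <|
    (L2.summable f).comp_injective (i := fun x => e.symm (x, y)) fun a b hab => by simpa using hab⟩
  map_add' _ _ := rfl
  map_smul' _ _ := rfl

theorem slice_apply (e : Z ≃ X × Y) (y : Y) (f : L2 Z) (x : X) :
    slice e y f x = f (e.symm (x, y)) := rfl

theorem summable_slice (e : Z ≃ X × Y) (f : L2 Z) : Summable fun y => ‖slice e y f‖ ^ 2 := by
  have h1 : Summable fun p : Y × X => ‖f (e.symm (p.2, p.1))‖ ^ 2 :=
    (((Equiv.prodComm Y X).trans e.symm).summable_iff (f := fun z => ‖f z‖ ^ 2)).2 (L2.summable f)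
  simp only [L2.norm_sq]
  exact h1.prod

theorem tsum_slice (e : Z ≃ X × Y) (f : L2 Z) : ∑' y, ‖slice e y f‖ ^ 2 = ‖f‖ ^ 2 := by
  have h1 : Summable fun p : Y × X => ‖f (e.symm (p.2, p.1))‖ ^ 2 :=
    (((Equiv.prodComm Y X).trans e.symm).summable_iff (f := fun z => ‖f z‖ ^ 2)).2 (L2.summable f)
  rw [L2.norm_sq f, ← ((Equiv.prodComm Y X).trans e.symm).tsum_eq (fun z => ‖f z‖ ^ 2)]
  simp only [L2.norm_sq]
  exact (h1.tsum_prod).symm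

/-- A family of square-summable sections with summable squared norms is square-summable. -/
theorem memL2_of_slices (e : Z ≃ X × Y) (g : Y → L2 X) (hg : Summable fun y => ‖g y‖ ^ 2) :
    Memℓp (fun z : Z => g (e z).2 (e z).1) 2 := by
  rw [memL2_iff]
  have h2 : Summable fun p : Y × X => ‖g p.1 p.2‖ ^ 2 := by
    rw [summable_prod_of_nonneg (fun p => by positivity)]
    exact ⟨fun y => L2.summable (g y), by simpa [L2.norm_sq] using hg⟩
  exact ((e.trans (Equiv.prodComm X Y)).summable_iff (f := fun p : Y × X => ‖g p.1 p.2‖ ^ 2)).2 h2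

theorem summable_map_slice (e : Z ≃ X × Y) (A : L2 X →L[ℂ] L2 X) (f : L2 Z) :
    Summable fun y => ‖A (slice e y f)‖ ^ 2 := by
  refine Summable.of_nonneg_of_le (fun y => by positivity) (fun y => ?_)
    ((summable_slice e f).mul_left (‖A‖ ^ 2))
  rw [← mul_pow]
  gcongr
  exact A.le_opNorm _

/-- For an identification `Z ≃ X × Y`, hence `ℓ²(Z) = ℓ²(X) ⊗ ℓ²(Y)`, the operator `A ⊗ 1`, as a
linear map: it applies `A` to each section. -/
def tensorOneLin (e : Z ≃ X × Y) (A : L2 X →L[ℂ] L2 X) : L2 Z →ₗ[ℂ] L2 Z where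
  toFun f := ⟨fun z => A (slice e (e z).2 f) (e z).1,
    memL2_of_slices e (fun y => A (slice e y f)) (summable_map_slice e A f)⟩
  map_add' f g := by
    ext z
    simp
    rfl
  map_smul' c f := by
    ext z
    simp

theorem slice_tensorOneLin (e : Z ≃ X × Y) (A : L2 X →L[ℂ] L2 X) (f : L2 Z) (y : Y) :
    slice e y (tensorOneLin e A f) = A (slice e y f) := by
  ext x
  simp [slice_apply, tensorOneLin]

theorem norm_tensorOneLin_le (e : Z ≃ X × Y) (A : L2 X →L[ℂ] L2 X) (f : L2 Z) :
    ‖tensorOneLin e A f‖ ≤ ‖A‖ * ‖f‖ := by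
  refine le_of_sq_le_sq ?_ (by positivity)
  rw [mul_pow, ← tsum_slice e, ← tsum_slice e f, ← tsum_mul_left]
  simp only [slice_tensorOneLin]
  refine (summable_map_slice e A f).tsum_le_tsum (fun y => ?_)
    ((summable_slice e f).mul_left (‖A‖ ^ 2))
  rw [← mul_pow]
  gcongr
  exact A.le_opNorm _

/-- The bounded operator `A ⊗ 1` on `ℓ²(Z) = ℓ²(X) ⊗ ℓ²(Y)`. -/
def tensorOne (e : Z ≃ X × Y) (A : L2 X →L[ℂ] L2 X) : L2 Z →L[ℂ] L2 Z :=
  (tensorOneLin e A).mkContinuous ‖A‖ (norm_tensorOneLin_le e A)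

theorem slice_tensorOne (e : Z ≃ X × Y) (A : L2 X →L[ℂ] L2 X) (f : L2 Z) (y : Y) :
    slice e y (tensorOne e A f) = A (slice e y f) := slice_tensorOneLin e A f y

theorem ext_slice (e : Z ≃ X × Y) {f g : L2 Z} (h : ∀ y, slice e y f = slice e y g) : f = g := by
  ext z
  have := congrArg (fun k : L2 X => k (e z).1) (h (e z).2)
  simpa [slice_apply] using this

theorem inner_eq_tsum_slice (e : Z ≃ X × Y) (f g : L2 Z) :
    ⟪f, g⟫_ℂ = ∑' y, ⟪slice e y f, slice e y g⟫_ℂ := by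
  have h1 : Summable fun p : Y × X => ⟪f (e.symm (p.2, p.1)), g (e.symm (p.2, p.1))⟫_ℂ :=
    (((Equiv.prodComm Y X).trans e.symm).summable_iff (f := fun z => ⟪f z, g z⟫_ℂ)).2
      (lp.summable_inner f g)
  rw [lp.inner_eq_tsum f g, ← ((Equiv.prodComm Y X).trans e.symm).tsum_eq]
  simp only [lp.inner_eq_tsum]
  exact h1.tsum_prod

theorem star_tensorOne (e : Z ≃ X × Y) (A : L2 X →L[ℂ] L2 X) :
    star (tensorOne e A) = tensorOne e (star A) := by
  rw [ContinuousLinearMap.star_eq_adjoint, ContinuousLinearMap.star_eq_adjoint, eq_comm,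
    ContinuousLinearMap.eq_adjoint_iff]
  intro f g
  rw [inner_eq_tsum_slice e, inner_eq_tsum_slice e]
  simp [slice_tensorOne, ContinuousLinearMap.adjoint_inner_left]

theorem tensorOne_mul (e : Z ≃ X × Y) (A B : L2 X →L[ℂ] L2 X) :
    tensorOne e (A * B) = tensorOne e A * tensorOne e B := by
  ext1 f
  refine ext_slice e fun y => ?_
  simp [slice_tensorOne]

theorem tensorOne_one (e : Z ≃ X × Y) : tensorOne e (1 : L2 X →L[ℂ] L2 X) = 1 := by
  ext1 f
  refine ext_slice e fun y => ?_
  simp [slice_tensorOne]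

/-- `A ↦ A ⊗ 1` maps strongly continuous families of contractions to strongly continuous ones. -/
theorem continuous_tensorOne {C : Type*} [TopologicalSpace C] (e : Z ≃ X × Y)
    (A : C → L2 X →L[ℂ] L2 X) (hA : ∀ σ, ‖A σ‖ ≤ 1) (hc : ∀ x, Continuous fun σ => A σ x)
    (f : L2 Z) : Continuous fun σ => tensorOne e (A σ) f := by
  rw [continuous_iff_continuousAt]
  intro τ
  have key : Continuous fun σ => ∑' y, ‖A σ (slice e y f) - A τ (slice e y f)‖ ^ 2 := by
    refine continuous_tsum (u := fun y => 4 * ‖slice e y f‖ ^ 2)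
      (fun y => (((hc _).sub continuous_const).norm).pow 2)
      ((summable_slice e f).mul_left 4) fun y σ => ?_
    have h1 : ‖A σ (slice e y f) - A τ (slice e y f)‖ ≤ 2 * ‖slice e y f‖ := by
      refine (norm_sub_le _ _).trans ?_
      have := (A σ).le_of_opNorm_le (hA σ) (slice e y f)
      have := (A τ).le_of_opNorm_le (hA τ) (slice e y f)
      linarith
    rw [Real.norm_of_nonneg (by positivity)]
    calc _ ≤ (2 * ‖slice e y f‖) ^ 2 := by gcongr
      _ = _ := by ring
  have hk : ∀ σ, ‖tensorOne e (A σ) f - tensorOne e (A τ) f‖ ^ 2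
      = ∑' y, ‖A σ (slice e y f) - A τ (slice e y f)‖ ^ 2 := fun σ => by
    rw [← tsum_slice e]
    simp [slice_tensorOne]
  rw [ContinuousAt, tendsto_iff_norm_sub_tendsto_zero]
  have h0 := key.tendsto τ
  simp only [sub_self, norm_zero, ne_eq, OfNat.ofNat_ne_zero, not_false_eq_true, zero_pow,
    tsum_zero] at h0
  simp only [← hk] at h0
  have := h0.sqrt
  simpa using this

end SquareSummable

section TensorPower

/-- Absolutely convergent families satisfy `∑_α ∏_k f_k(α_k) = ∏_k ∑_j f_k(j)`. -/
theorem summable_tsum_prod_fin {J : Type*} : ∀ (n : ℕ) (f : Fin n → J → ℂ),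
    (∀ k, Summable fun j => ‖f k j‖) →
      (Summable fun α : Fin n → J => ‖∏ k, f k (α k)‖) ∧
        ∑' α : Fin n → J, ∏ k, f k (α k) = ∏ k, ∑' j, f k j
  | 0, f, _ => by
    refine ⟨(hasSum_fintype _).summable, ?_⟩
    simp
  | n + 1, f, hf => by
    obtain ⟨h1, h2⟩ := summable_tsum_prod_fin n (fun k => f k.succ) fun k => hf k.succ
    have hs := (hf 0).mul_norm h1
    have he : ∀ p : J × (Fin n → J), ∏ k, f k (Fin.consEquiv (fun _ => J) p k)
        = f 0 p.1 * ∏ k : Fin n, f k.succ (p.2 k) := fun p => by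
      simp [Fin.prod_univ_succ, Fin.consEquiv]
    constructor
    · rw [← (Fin.consEquiv fun _ : Fin (n + 1) => J).summable_iff]
      simpa only [Function.comp_def, he] using hs
    · rw [← (Fin.consEquiv fun _ : Fin (n + 1) => J).tsum_eq]
      simp only [he]
      rw [Fin.prod_univ_succ, ← h2, tsum_mul_tsum_of_summable_norm (hf 0) h1]

theorem summable_tsum_prod {ι J : Type*} [Fintype ι] (f : ι → J → ℂ)
    (hf : ∀ k, Summable fun j => ‖f k j‖) :
    (Summable fun α : ι → J => ‖∏ k, f k (α k)‖) ∧
      ∑' α : ι → J, ∏ k, f k (α k) = ∏ k, ∑' j, f k j := by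
  let e := Fintype.equivFin ι
  obtain ⟨h1, h2⟩ := summable_tsum_prod_fin (Fintype.card ι) (fun k => f (e.symm k))
    fun k => hf _
  have he : ∀ α : Fin (Fintype.card ι) → J, ∏ k, f k ((Equiv.arrowCongr e.symm (Equiv.refl J)) α k)
      = ∏ k, f (e.symm k) (α k) := fun α => by
    rw [← e.symm.prod_comp]
    simp [Equiv.arrowCongr]
  constructor
  · rw [← (Equiv.arrowCongr e.symm (Equiv.refl J)).summable_iff]
    simpa only [Function.comp_def, he] using h1
  · rw [← (Equiv.arrowCongr e.symm (Equiv.refl J)).tsum_eq]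
    simp only [he]
    rw [h2, e.symm.prod_comp (fun k => ∑' j, f k j)]

variable (H : Type*) [NormedAddCommGroup H] [InnerProductSpace ℂ H] [CompleteSpace H]

/-- The index set of a fixed orthonormal basis of `H`. -/
def OnbIdx : Set H := (exists_hilbertBasis ℂ H).choose

/-- A fixed orthonormal (Hilbert) basis of `H`. -/
def onb : HilbertBasis (OnbIdx H) ℂ H := (exists_hilbertBasis ℂ H).choose_spec.choose

/-- The Hilbert space tensor power `H^{⊗N}`, realised through coordinates with respect to a fixed
orthonormal basis of `H`. With `productVector` below it is characterised, up to a unique unitary, by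
`inner_productVector` and `dense_span_productVector`. -/
abbrev TensorPower (N : ℕ) : Type _ := L2 (Fin N → OnbIdx H)

variable {H}

theorem summable_onb (φ : H) : Summable fun j => ‖(onb H).repr φ j‖ ^ 2 := L2.summable _

/-- The product vector `φ_1 ⊗ ⋯ ⊗ φ_N`. -/
def productVector {N : ℕ} (φ : Fin N → H) : TensorPower H N :=
  ⟨fun α => ∏ k, (onb H).repr (φ k) (α k), memL2_iff.2 <| by
    have := (summable_tsum_prod (fun k j => ((onb H).repr (φ k) j) ^ 2)
      fun k => by simpa using summable_onb (φ k)).1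
    simpa [Finset.prod_pow] using this⟩

theorem productVector_apply {N : ℕ} (φ : Fin N → H) (α : Fin N → OnbIdx H) :
    productVector φ α = ∏ k, (onb H).repr (φ k) (α k) := rfl

theorem inner_eq_tsum_onb (φ χ : H) :
    ⟪φ, χ⟫_ℂ = ∑' j, starRingEnd ℂ ((onb H).repr φ j) * (onb H).repr χ j := by
  rw [← L2.inner_eq, LinearIsometryEquiv.inner_map_map]

theorem inner_productVector {N : ℕ} (φ χ : Fin N → H) :
    ⟪productVector φ, productVector χ⟫_ℂ = ∏ k, ⟪φ k, χ k⟫_ℂ := by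
  have h2 := (summable_tsum_prod
    (fun k j => starRingEnd ℂ ((onb H).repr (φ k) j) * (onb H).repr (χ k) j) fun k =>
    L2.summable_norm_mul ((onb H).repr (φ k)) ((onb H).repr (χ k))).2
  simp only [← inner_eq_tsum_onb] at h2
  rw [L2.inner_eq, ← h2]
  refine tsum_congr fun α => ?_
  simp only [productVector_apply, Finset.prod_mul_distrib, map_prod]

theorem dense_span_productVector (N : ℕ) :
    Dense (Submodule.span ℂ (Set.range (productVector : (Fin N → H) → TensorPower H N)) :
      Set (TensorPower H N)) := by
  classical
  let b : HilbertBasis (Fin N → OnbIdx H) ℂ (TensorPower H N) :=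
    ⟨LinearIsometryEquiv.refl ℂ _⟩
  have hb : ∀ α, b α = productVector fun k => onb H (α k) := fun α => by
    ext β
    have h1 : b α = lp.single 2 α (1 : ℂ) := by
      rw [← b.repr_symm_single]
      rfl
    rw [h1, productVector_apply]
    simp only [HilbertBasis.repr_self, lp.single_apply, Pi.single_apply]
    by_cases hβ : β = α
    · subst hβ
      simp
    · obtain ⟨k, hk⟩ := Function.ne_iff.1 hβ
      rw [if_neg hβ, Finset.prod_eq_zero (Finset.mem_univ k)]
      simp [hk]
  have h2 := b.dense_span
  rw [← Submodule.dense_iff_topologicalClosure_eq_top] at h2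
  refine h2.mono (Submodule.span_mono ?_)
  rintro _ ⟨α, rfl⟩
  exact ⟨_, (hb α).symm⟩

/-- Splitting a multi-index into its entries at two distinct positions `i`, `j` (in this order)
and the remaining ones. -/
def pairSplit {N : ℕ} (J : Type*) (i j : Fin N) (hij : i ≠ j) :
    (Fin N → J) ≃ (Fin 2 → J) × ({k : Fin N // k ≠ i ∧ k ≠ j} → J) where
  toFun α := (![α i, α j], fun k => α k)
  invFun p k := if hi : k = i then p.1 0 else if hj : k = j then p.1 1 else p.2 ⟨k, hi, hj⟩
  left_inv α := by
    funext k
    by_cases hi : k = i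
    · simp [hi]
    · by_cases hj : k = j
      · subst hj
        simp [hi]
      · simp [hi, hj]
  right_inv p := by
    refine Prod.ext ?_ ?_
    · funext m
      fin_cases m <;> simp [hij.symm]
    · funext k
      simp [k.2.1, k.2.2]

/-- For an operator `A` on `H ⊗ H`, the operator `A_{i,j}` on `H^{⊗N}`, which acts as `A` on
the `i`-th and `j`-th factors and trivially on the others. -/
def pairOp {N : ℕ} (i j : Fin N) (hij : i ≠ j) (A : TensorPower H 2 →L[ℂ] TensorPower H 2) :
    TensorPower H N →L[ℂ] TensorPower H N :=
  tensorOne (pairSplit _ i j hij) A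

theorem slice_productVector {N : ℕ} (i j : Fin N) (hij : i ≠ j) (φ : Fin N → H)
    (y : {k : Fin N // k ≠ i ∧ k ≠ j} → OnbIdx H) :
    slice (pairSplit _ i j hij) y (productVector φ)
      = (∏ k, (onb H).repr (φ k.1) (y k)) • productVector ![φ i, φ j] := by
  ext x
  have hj : j ∈ Finset.univ.erase i := by simp [hij.symm]
  have hs : ((Finset.univ.erase i).erase j) = Finset.univ.filter fun k => k ≠ i ∧ k ≠ j := by
    ext k
    simp [and_comm]
  have hp := Finset.prod_subtype (p := fun k => k ≠ i ∧ k ≠ j) (F := inferInstance)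
    (Finset.univ.filter fun k => k ≠ i ∧ k ≠ j) (by simp)
    fun k => (onb H).repr (φ k) ((pairSplit (OnbIdx H) i j hij).symm (x, y) k)
  rw [slice_apply, productVector_apply, ← Finset.mul_prod_erase _ _ (Finset.mem_univ i),
    ← Finset.mul_prod_erase _ _ hj, hs, hp]
  have h0 : ∀ k : {k : Fin N // k ≠ i ∧ k ≠ j},
      (pairSplit (OnbIdx H) i j hij).symm (x, y) k = y k := fun k => by
    simp [pairSplit, k.2.1, k.2.2]
  simp only [h0]
  simp [productVector_apply, Fin.prod_univ_two, pairSplit, hij.symm]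
  ring

/-- The matrix elements of `A_{i,j}` between product vectors; they determine `A_{i,j}`. -/
theorem inner_productVector_pairOp {N : ℕ} (i j : Fin N) (hij : i ≠ j)
    (A : TensorPower H 2 →L[ℂ] TensorPower H 2) (χ φ : Fin N → H) :
    ⟪productVector χ, pairOp i j hij A (productVector φ)⟫_ℂ
      = ⟪productVector ![χ i, χ j], A (productVector ![φ i, φ j])⟫_ℂ
        * ∏ k : {k : Fin N // k ≠ i ∧ k ≠ j}, ⟪χ k, φ k⟫_ℂ := by
  have h2 := (summable_tsum_prod (ι := {k : Fin N // k ≠ i ∧ k ≠ j})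
    (fun k m => starRingEnd ℂ ((onb H).repr (χ k) m) * (onb H).repr (φ k) m) fun k =>
    L2.summable_norm_mul ((onb H).repr (χ k)) ((onb H).repr (φ k))).2
  simp only [← inner_eq_tsum_onb] at h2
  rw [inner_eq_tsum_slice (pairSplit _ i j hij), ← h2, ← tsum_mul_left]
  refine tsum_congr fun y => ?_
  simp only [pairOp, slice_tensorOne, slice_productVector, map_smul, inner_smul_left, inner_smul_right,
    Finset.prod_mul_distrib, map_prod]
  ring

/-- The reindexing `f ↦ f ∘ e` of square-summable families. -/
def reindex {X : Type*} (e : X ≃ X) : L2 X →L[ℂ] L2 X :=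
  LinearMap.mkContinuous
    { toFun := fun f => (⟨fun x => f (e x), memL2_iff.2 <|
        (L2.summable f).comp_injective e.injective⟩ : L2 X)
      map_add' := fun _ _ => rfl
      map_smul' := fun _ _ => rfl } 1 fun f => by
    rw [one_mul]
    refine le_of_sq_le_sq (le_of_eq ?_) (norm_nonneg _)
    rw [L2.norm_sq, L2.norm_sq]
    exact e.tsum_eq (fun x => ‖f x‖ ^ 2)

/-- The swap `V (φ ⊗ ψ) = ψ ⊗ φ` on `H ⊗ H`. -/
def swap : TensorPower H 2 →L[ℂ] TensorPower H 2 :=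
  reindex (Equiv.arrowCongr (Equiv.swap (0 : Fin 2) 1) (Equiv.refl (OnbIdx H)))

theorem swap_productVector (φ ψ : H) : swap (productVector ![φ, ψ]) = productVector ![ψ, φ] := by
  ext α
  change productVector ![φ, ψ] (fun k => α (Equiv.swap 0 1 k)) = _
  simp [productVector_apply, Fin.prod_univ_two, mul_comm]

end TensorPower

section States

variable {K : Type*} [NormedAddCommGroup K] [InnerProductSpace ℂ K] [CompleteSpace K]

/-- The trace `∑_j ⟨b_j, T b_j⟩ ∈ [0, ∞]` of a positive operator `T` (`b` an orthonormal basis). -/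
def posTrace (T : K →L[ℂ] K) : ENNReal :=
  ∑' j, ENNReal.ofReal (RCLike.re ⟪onb K j, T (onb K j)⟫_ℂ)

/-- The Parseval identity, in `[0, ∞]`. -/
theorem tsum_ofReal_norm_inner_sq {ι E : Type*} [NormedAddCommGroup E]
    [InnerProductSpace ℂ E] (b : HilbertBasis ι ℂ E) (x : E) :
    ∑' j, ENNReal.ofReal (‖⟪b j, x⟫_ℂ‖ ^ 2) = ENNReal.ofReal (‖x‖ ^ 2) := by
  have h := L2.summable (b.repr x)
  rw [← LinearIsometryEquiv.norm_map b.repr x, L2.norm_sq,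
    ENNReal.ofReal_tsum_of_nonneg (fun _ => by positivity) h]
  simp [HilbertBasis.repr_apply_apply]

/-- The trace of a positive operator does not depend on the orthonormal basis. -/
theorem posTrace_eq {ι : Type*} (b : HilbertBasis ι ℂ K) {T : K →L[ℂ] K} (hT : T.IsPositive) :
    posTrace T = ∑' j, ENNReal.ofReal (RCLike.re ⟪b j, T (b j)⟫_ℂ) := by
  have hT' : 0 ≤ T := (ContinuousLinearMap.nonneg_iff_isPositive T).2 hT
  let S := CFC.sqrt T
  have hS : IsSelfAdjoint S := (CFC.sqrt_nonneg T).isSelfAdjoint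
  have hS2 : S * S = T := CFC.sqrt_mul_sqrt_self T
  have hin : ∀ x y : K, ⟪S x, y⟫_ℂ = ⟪x, S y⟫_ℂ := fun x y => by
    rw [← ContinuousLinearMap.adjoint_inner_right, ← ContinuousLinearMap.star_eq_adjoint, hS.star_eq]
  have h1 : ∀ x : K, RCLike.re ⟪x, T x⟫_ℂ = ‖S x‖ ^ 2 := fun x => by
    rw [← hS2, mul_apply_eq_comp, ← hin, inner_self_eq_norm_sq]
  simp only [posTrace, h1]
  calc _ = ∑' i, ∑' j, ENNReal.ofReal (‖⟪b j, S (onb K i)⟫_ℂ‖ ^ 2) := by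
        simp only [tsum_ofReal_norm_inner_sq]
    _ = ∑' j, ∑' i, ENNReal.ofReal (‖⟪b j, S (onb K i)⟫_ℂ‖ ^ 2) := ENNReal.tsum_comm
    _ = ∑' j, ∑' i, ENNReal.ofReal (‖⟪onb K i, S (b j)⟫_ℂ‖ ^ 2) := by
        refine tsum_congr fun j => tsum_congr fun i => ?_
        rw [← hin, norm_inner_symm]
    _ = _ := by simp only [tsum_ofReal_norm_inner_sq]

/-- The trace norm `‖A‖₁ = Tr |A| = Tr (A* A)^{1/2} ∈ [0, ∞]`; `A` is of trace class if and only if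
it is finite. -/
def traceNorm (A : K →L[ℂ] K) : ENNReal := posTrace (CFC.abs A)

/-- Density matrices: positive operators of trace one. -/
def IsDensity (ϱ : K →L[ℂ] K) : Prop := ϱ.IsPositive ∧ posTrace ϱ = 1

variable {H : Type*} [NormedAddCommGroup H] [InnerProductSpace ℂ H] [CompleteSpace H]

/-- Product states: density matrices `ϱ = ρ_1 ⊗ ⋯ ⊗ ρ_N` on `H^{⊗N}`, where each `ρ_j` is a density
matrix on `H`. -/
def productStates (H : Type*) [NormedAddCommGroup H] [InnerProductSpace ℂ H] [CompleteSpace H]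
    (N : ℕ) : Set (TensorPower H N →L[ℂ] TensorPower H N) :=
  {ϱ | IsDensity ϱ ∧ ∃ ρ : Fin N → H →L[ℂ] H, (∀ j, IsDensity (ρ j)) ∧
    ∀ φ : Fin N → H, ϱ (productVector φ) = productVector fun j => ρ j (φ j)}

/-- Separable states: density matrices in the closed convex hull (for the trace norm) of the
product states. -/
def IsSeparable {N : ℕ} (ϱ : TensorPower H N →L[ℂ] TensorPower H N) : Prop :=
  IsDensity ϱ ∧ ∀ ε : ENNReal, 0 < ε →
    ∃ ω ∈ convexHull ℝ (productStates H N), traceNorm (ϱ - ω) < ε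

end States

section Hamiltonian

variable {H : Type*} [NormedAddCommGroup H] [InnerProductSpace ℂ H] [CompleteSpace H]

/-- Single-particle Hamiltonians: (possibly unbounded) self-adjoint operators that are bounded
below and have compact resolvent. Their eigenvalues, repeated according to multiplicity, can be
arranged in an increasing sequence, finite or tending to `+∞`. -/
structure Hamiltonian (H : Type*) [NormedAddCommGroup H] [InnerProductSpace ℂ H]
    [CompleteSpace H] where
  /-- the operator, with its domain -/
  op : H →ₗ.[ℂ] H
  selfAdjoint : IsSelfAdjoint op
  boundedBelow : ∃ c : ℝ, ∀ x : op.domain, c * ‖(x : H)‖ ^ 2 ≤ RCLike.re ⟪(x : H), op x⟫_ℂ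
  /-- `(h - z)⁻¹` exists and is compact for some real `z` -/
  compactResolvent : ∃ z : ℝ, ∃ R : H →L[ℂ] H, IsCompactOperator R ∧
    (∀ y : H, ∃ hy : R y ∈ op.domain, op ⟨R y, hy⟩ - (z : ℂ) • R y = y) ∧
    ∀ x : op.domain, R (op x - (z : ℂ) • (x : H)) = x

namespace Hamiltonian

variable (h : Hamiltonian H)

/-- The graph of the `N`-particle Hamiltonian `H_N = ∑_j h_j`: the closure of the graph of `∑_j h_j`
on the linear span of the product vectors with all factors in the domain of `h`. -/
def graph (N : ℕ) : Submodule ℂ (TensorPower H N × TensorPower H N) :=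
  (Submodule.span ℂ (Set.range fun φ : Fin N → h.op.domain =>
    (productVector (fun k => (φ k : H)),
      ∑ j, productVector (Function.update (fun k => (φ k : H)) j (h.op (φ j)))))).topologicalClosure

/-- The energy shell `K_E`: the eigenspace `{x | H_N x = E x}` of `H_N`. -/
def shell (N : ℕ) (E : ℝ) : Submodule ℂ (TensorPower H N) :=
  (h.graph N).comap (LinearMap.prod LinearMap.id ((E : ℂ) • LinearMap.id))

instance completeSpace_shell (N : ℕ) (E : ℝ) : CompleteSpace (h.shell N E) := by
  have hc : IsClosed ((h.shell N E : Submodule ℂ (TensorPower H N)) : Set (TensorPower H N)) := by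
    have h1 : IsClosed (h.graph N : Set (TensorPower H N × TensorPower H N)) :=
      Submodule.isClosed_topologicalClosure _
    have h2 : Continuous fun x : TensorPower H N => (x, (E : ℂ) • x) := by fun_prop
    exact h1.preimage h2
  exact hc.completeSpace_coe

/-- The energy algebra `A_N`: the operators `f(H_N) = ∑_E f(E) P_E` for bounded functions `f` on the
(discrete) spectrum, where `P_E` is the orthogonal projection onto the energy shell `K_E` and the sum
converges strongly. (`P_E = 0` if `E` is not an eigenvalue.) -/
def energyAlgebra (N : ℕ) : Set (TensorPower H N →L[ℂ] TensorPower H N) :=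
  {A | ∃ f : ℝ → ℂ, (∃ M : ℝ, ∀ E, ‖f E‖ ≤ M) ∧
    ∀ x, HasSum (fun E : ℝ => f E • (h.shell N E).starProjection x) (A x)}

end Hamiltonian

end Hamiltonian

section Collisions

section Average

variable {K : Type*} [NormedAddCommGroup K] [InnerProductSpace ℂ K] [CompleteSpace K]

theorem norm_unitary_le {W : K →L[ℂ] K} (hW : W ∈ unitary (K →L[ℂ] K)) : ‖W‖ ≤ 1 := by
  refine ContinuousLinearMap.opNorm_le_bound _ zero_le_one fun x => ?_
  have h1 : star W * W = 1 := Unitary.star_mul_self_of_mem hW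
  have h2 : ‖W x‖ ^ 2 = ‖x‖ ^ 2 := by
    rw [← inner_self_eq_norm_sq (𝕜 := ℂ), ← inner_self_eq_norm_sq (𝕜 := ℂ) x,
      ← ContinuousLinearMap.adjoint_inner_right, ← ContinuousLinearMap.star_eq_adjoint,
      ← mul_apply_eq_comp, h1, one_apply_eq_self]
  rw [one_mul]
  exact (pow_le_pow_iff_left₀ (norm_nonneg _) (norm_nonneg _) two_ne_zero).1 h2.le

theorem continuous_star_unitary {C : Type*} [TopologicalSpace C] (W : C → K →L[ℂ] K)
    (hW : ∀ σ, W σ ∈ unitary (K →L[ℂ] K)) (hc : ∀ x, Continuous fun σ => W σ x) (x : K) :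
    Continuous fun σ => star (W σ) x := by
  rw [continuous_iff_continuousAt]
  intro τ
  have h1 : ∀ σ z, W σ (star (W σ) z) = z := fun σ z => by
    rw [← mul_apply_eq_comp, Unitary.mul_star_self_of_mem (hW σ)]
    rfl
  have h2 : ∀ σ z, star (W σ) (W σ z) = z := fun σ z => by
    rw [← mul_apply_eq_comp, Unitary.star_mul_self_of_mem (hW σ)]
    rfl
  rw [ContinuousAt, tendsto_iff_norm_sub_tendsto_zero]
  have h3 : Tendsto (fun σ => ‖W τ (star (W τ) x) - W σ (star (W τ) x)‖) (𝓝 τ) (𝓝 0) := by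
    have : Continuous fun σ => ‖W τ (star (W τ) x) - W σ (star (W τ) x)‖ :=
      (continuous_const.sub (hc _)).norm
    simpa using this.tendsto τ
  refine squeeze_zero (fun _ => norm_nonneg _) (fun σ => ?_) h3
  have h4 : star (W σ) x - star (W τ) x
      = star (W σ) (W τ (star (W τ) x) - W σ (star (W τ) x)) := by
    rw [map_sub, h1 τ, h2 σ]
  rw [h4]
  exact ContinuousLinearMap.le_of_opNorm_le _ (norm_unitary_le (Unitary.star_mem (hW σ))) _
    |>.trans_eq (one_mul _)

variable {C : Type*} [TopologicalSpace C]

theorem continuous_conj (W : C → K →L[ℂ] K)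
    (hW : ∀ σ, W σ ∈ unitary (K →L[ℂ] K)) (hc : ∀ x, Continuous fun σ => W σ x)
    (A : K →L[ℂ] K) (y : K) :
    Continuous fun σ => W σ (A (star (W σ) y)) := by
  rw [continuous_iff_continuousAt]
  intro τ
  have hz : Continuous fun σ => A (star (W σ) y) :=
    A.continuous.comp (continuous_star_unitary W hW hc y)
  rw [ContinuousAt, tendsto_iff_norm_sub_tendsto_zero]
  have h3 : Tendsto (fun σ => ‖A (star (W σ) y) - A (star (W τ) y)‖
      + ‖W σ (A (star (W τ) y)) - W τ (A (star (W τ) y))‖) (𝓝 τ) (𝓝 0) := by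
    have : Continuous fun σ => ‖A (star (W σ) y) - A (star (W τ) y)‖
      + ‖W σ (A (star (W τ) y)) - W τ (A (star (W τ) y))‖ :=
      (hz.sub continuous_const).norm.add ((hc _).sub continuous_const).norm
    simpa using this.tendsto τ
  refine squeeze_zero (fun _ => norm_nonneg _) (fun σ => ?_) h3
  calc _ = ‖W σ (A (star (W σ) y) - A (star (W τ) y))
        + (W σ (A (star (W τ) y)) - W τ (A (star (W τ) y)))‖ := by
        rw [map_sub]
        congr 1
        abel
    _ ≤ _ := (norm_add_le _ _).trans (by
        gcongr
        exact ((W σ).le_of_opNorm_le (norm_unitary_le (hW σ)) _).trans_eq (one_mul _))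

variable [CompactSpace C] [MeasurableSpace C] [BorelSpace C]

theorem integrable_conj (W : C → K →L[ℂ] K)
    (hW : ∀ σ, W σ ∈ unitary (K →L[ℂ] K)) (hc : ∀ x, Continuous fun σ => W σ x)
    (ν : Measure C) [IsProbabilityMeasure ν]
    (A : K →L[ℂ] K) (y : K) :
    Integrable (fun σ => W σ (A (star (W σ) y))) ν := by
  have h := continuous_conj W hW hc A y
  exact h.integrable_of_hasCompactSupport (HasCompactSupport.of_compactSpace _)

/-- For a strongly continuous family `W` of unitaries, the average
`A ↦ ∫ W(σ) A W(σ)* dν(σ)`, where the integral is taken in the strong sense. -/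
def conjAverage (W : C → K →L[ℂ] K)
    (hW : ∀ σ, W σ ∈ unitary (K →L[ℂ] K)) (hc : ∀ x, Continuous fun σ => W σ x)
    (ν : Measure C) [IsProbabilityMeasure ν] :
    (K →L[ℂ] K) →L[ℂ] (K →L[ℂ] K) :=
  LinearMap.mkContinuous₂
    (LinearMap.mk₂ ℂ (fun (A : K →L[ℂ] K) (y : K) => ∫ σ, W σ (A (star (W σ) y)) ∂ν)
      (fun A B y => by
        rw [← integral_add (integrable_conj W hW hc ν A y) (integrable_conj W hW hc ν B y)]
        simp)
      (fun c A y => by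
        rw [← integral_smul]
        simp)
      (fun A y z => by
        rw [← integral_add (integrable_conj W hW hc ν A y) (integrable_conj W hW hc ν A z)]
        simp)
      (fun c A y => by
        rw [← integral_smul]
        simp)) 1 fun A y => by
    rw [LinearMap.mk₂_apply]
    have h := norm_integral_le_of_norm_le_const (μ := ν) (C := 1 * ‖A‖ * ‖y‖)
      (f := fun σ => W σ (A (star (W σ) y))) (ae_of_all _ fun σ => by
        have h1 := (W σ).le_of_opNorm_le (norm_unitary_le (hW σ)) (A (star (W σ) y))
        have h2 := (star (W σ)).le_of_opNorm_le (norm_unitary_le (Unitary.star_mem (hW σ))) y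
        have h3 := A.le_opNorm (star (W σ) y)
        calc _ ≤ ‖A (star (W σ) y)‖ := by simpa using h1
          _ ≤ ‖A‖ * ‖star (W σ) y‖ := h3
          _ ≤ ‖A‖ * ‖y‖ := by
            gcongr
            simpa using h2
          _ = _ := by ring)
    simpa using h

theorem conjAverage_apply (W : C → K →L[ℂ] K)
    (hW : ∀ σ, W σ ∈ unitary (K →L[ℂ] K)) (hc : ∀ x, Continuous fun σ => W σ x)
    (ν : Measure C) [IsProbabilityMeasure ν]
    (A : K →L[ℂ] K) (y : K) :
    conjAverage W hW hc ν A y = ∫ σ, W σ (A (star (W σ) y)) ∂ν := rfl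

end Average

variable {H : Type*} [NormedAddCommGroup H] [InnerProductSpace ℂ H] [CompleteSpace H]

theorem pairOp_mem_unitary {N : ℕ} (i j : Fin N) (hij : i ≠ j)
    {A : TensorPower H 2 →L[ℂ] TensorPower H 2} (hA : A ∈ unitary _) :
    pairOp i j hij A ∈ unitary (TensorPower H N →L[ℂ] TensorPower H N) := by
  rw [Unitary.mem_iff, pairOp, star_tensorOne, ← tensorOne_mul, ← tensorOne_mul,
    Unitary.star_mul_self_of_mem hA, Unitary.mul_star_self_of_mem hA, tensorOne_one]
  exact ⟨rfl, rfl⟩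

/-- Collision specifications `(C, U, ν)` for the single-particle Hamiltonian `h`, where `C` is a
compact metric space. -/
structure CollisionSpec (h : Hamiltonian H) (C : Type*) [MetricSpace C] [CompactSpace C]
    [MeasurableSpace C] [BorelSpace C] where
  /-- the collision operators, unitaries on `H ⊗ H` -/
  U : C → TensorPower H 2 →L[ℂ] TensorPower H 2
  unitary_U : ∀ σ, U σ ∈ unitary (TensorPower H 2 →L[ℂ] TensorPower H 2)
  /-- `U` is continuous for the strong operator topology (in particular, `U` may be continuous for
  the operator norm) -/
  continuous_U : ∀ x, Continuous fun σ => U σ x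
  injective_U : Function.Injective U
  ν : Measure C
  isProbabilityMeasure_ν : IsProbabilityMeasure ν
  /-- `ν` charges all nonempty open sets -/
  isOpenPosMeasure_ν : ν.IsOpenPosMeasure
  /-- each `U(σ)` commutes with the (unbounded) two-particle Hamiltonian `H_2`, that is,
  `U(σ) H_2 U(σ)* = H_2`, as an identity of graphs -/
  commute_H2 : ∀ σ x y, (U σ x, U σ y) ∈ h.graph 2 ↔ (x, y) ∈ h.graph 2
  exists_trivial : ∃ σ₀, U σ₀ = 1
  /-- time reversal: `U(σ)* = U(σ')`, where `σ ↦ σ'` is measurable and leaves `ν` invariant -/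
  time_reversal : ∃ τ : C → C, MeasurePreserving τ ν ν ∧ ∀ σ, star (U σ) = U (τ σ)
  /-- exchange of the particles: `V U(σ) V* = U(σ')`, where `σ ↦ σ'` is measurable and leaves `ν`
  invariant -/
  exchange : ∃ τ : C → C, MeasurePreserving τ ν ν ∧ ∀ σ, swap * U σ * star swap = U (τ σ)

/-- The semigroup `exp(t L)` generated by a bounded operator `L` on a Banach space. -/
def expSemigroup {B : Type*} [NormedAddCommGroup B] [NormedSpace ℂ B] (L : B →L[ℂ] B) (t : ℝ) :
    B →L[ℂ] B :=
  NormedSpace.exp ((t : ℂ) • L)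

namespace CollisionSpec

variable {h : Hamiltonian H} {C : Type*} [MetricSpace C] [CompactSpace C] [MeasurableSpace C]
  [BorelSpace C] (S : CollisionSpec h C)

/-- Ergodicity: the commutant of the collision operators is the energy algebra `A_2`. -/
def IsErgodic : Prop := Set.centralizer (Set.range S.U) = h.energyAlgebra 2

theorem continuous_pairOp {N : ℕ} (i j : Fin N) (hij : i ≠ j) (x : TensorPower H N) :
    Continuous fun σ => pairOp i j hij (S.U σ) x :=
  continuous_tensorOne _ S.U (fun σ => norm_unitary_le (S.unitary_U σ)) S.continuous_U x

/-- `Q_{i,j} A = ∫ U_{i,j}(σ) A U_{i,j}(σ)* dν(σ)`. -/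
def pairAverage {N : ℕ} (i j : Fin N) (hij : i ≠ j) :
    (TensorPower H N →L[ℂ] TensorPower H N) →L[ℂ] (TensorPower H N →L[ℂ] TensorPower H N) :=
  haveI := S.isProbabilityMeasure_ν
  conjAverage (fun σ => pairOp i j hij (S.U σ))
    (fun σ => pairOp_mem_unitary i j hij (S.unitary_U σ)) (S.continuous_pairOp i j hij) S.ν

theorem pairAverage_apply {N : ℕ} (i j : Fin N) (hij : i ≠ j)
    (A : TensorPower H N →L[ℂ] TensorPower H N) (y : TensorPower H N) :
    S.pairAverage i j hij A y
      = ∫ σ, (pairOp i j hij (S.U σ) * A * star (pairOp i j hij (S.U σ))) y ∂S.ν := rfl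

/-- `Q_N = (N choose 2)⁻¹ ∑_{i<j} Q_{i,j}`. -/
def average (N : ℕ) :
    (TensorPower H N →L[ℂ] TensorPower H N) →L[ℂ] (TensorPower H N →L[ℂ] TensorPower H N) :=
  ((N.choose 2 : ℕ) : ℂ)⁻¹ •
    ∑ p : {p : Fin N × Fin N // p.1 < p.2}, S.pairAverage p.1.1 p.1.2 p.2.ne

/-- The quantum Kac generator `L_N = N (Q_N - 1)`. -/
def generator (N : ℕ) :
    (TensorPower H N →L[ℂ] TensorPower H N) →L[ℂ] (TensorPower H N →L[ℂ] TensorPower H N) :=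
  (N : ℂ) • (S.average N - 1)

/-- The evolution `P_{N,t} = exp(t L_N)` which solves the quantum Kac Master Equation
`dϱ/dt = L_N ϱ`. -/
def evolution (N : ℕ) (t : ℝ) :
    (TensorPower H N →L[ℂ] TensorPower H N) →L[ℂ] (TensorPower H N →L[ℂ] TensorPower H N) :=
  expSemigroup (S.generator N) t

end CollisionSpec

end Collisions

end QuantumKac

end

noncomputable section

namespace QuantumKac

/-! A Hamiltonian with compact resolvent has an orthonormal eigenbasis `ψ`, with finitely many
eigenvalues below each level. The product vectors of `ψ` form an eigenbasis of `H_N`, and for each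
`M` those of energy at most `M` span a finite-dimensional space. Collisions conserve energy, so the
projection `P` onto this space commutes with every `U_{i,j}(σ)`. Hence `Q_N` maps the corner of
operators `P A P` into itself and preserves the partial trace `Tr (P A)`.

Equilibria are diagonal. Let `X` be self-adjoint with `Q_N X = X`. Then `X` is an average of unitary
conjugates of itself. On the range of `P` these all have the same Hilbert–Schmidt norm as `X`, so by
strict convexity they all equal `X` (`conj_eq_of_average_eq`). The averaged squared defect vanishes,
and strong continuity with full support of `ν` removes the exceptional null set. So `X` commutes
with every `U_{i,j}(σ)`, and its blocks relative to the pair `(i,j)` lie in the commutant, which is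
the energy algebra by ergodicity. The product eigenvectors `ψ_a ⊗ ψ_b` lie in energy shells, so the
blocks commute with the projections onto them. Thus `X` does not couple multi-indices that differ at
`i` or `j` (`inner_eq_zero_of_commute_pairOp`). A density matrix diagonal in a product basis is a
trace-norm limit of finite convex combinations of pure product states (`isSeparable_of_diagonal`).

Convergence. `Q_N` is a contraction in operator norm, and `exp(s(Q-1))` is the Poisson mixture of
the powers `Q^k`. The concentration of the Poisson law gives `‖exp(s(Q-1))(Q-1)‖ ≤ s^{-1/2}`. On
each finite-dimensional corner every vector is a fixed vector plus an element of the range of `Q-1`,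
so the semigroup converges there. Density matrices are norm limits of their corners, so they
converge in operator norm (`exists_tendsto_expSemigroup`). Conservation of the partial traces
prevents mass from escaping to high energy; this upgrades the convergence to trace norm and makes
the limit a density matrix (`exists_tendsto_evolution`). -/

theorem hasSum_congr_fun {M ι : Type*} [AddCommMonoid M] [TopologicalSpace M] {f g : ι → M} {a b : M}
    (h : HasSum f a) (hf : ∀ i, g i = f i) (ha : b = a) : HasSum g b := by
  rwa [funext hf, ha]

/-! ### Moments of the Poisson distribution -/

section Poisson

/-- The Poisson weights `e^{-s} s^k / k!`. -/
def poissonWeight (s : ℝ) (k : ℕ) : ℝ := Real.exp (-s) * (s ^ k / k.factorial)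

theorem poissonWeight_nonneg {s : ℝ} (hs : 0 ≤ s) (k : ℕ) : 0 ≤ poissonWeight s k := by
  unfold poissonWeight
  positivity

/-- Size-biasing: weighting by `k` amounts to a shift by one. The moments below follow from it, and
so does the formula for `Q` times the semigroup. -/
theorem succ_mul_poissonWeight (s : ℝ) (k : ℕ) :
    ((k + 1 : ℕ) : ℝ) * poissonWeight s (k + 1) = s * poissonWeight s k := by
  have h : ((k.factorial : ℕ) : ℝ) ≠ 0 := by positivity
  have h' : ((k : ℝ) + 1) ≠ 0 := by positivity
  simp only [poissonWeight, Nat.factorial_succ, pow_succ]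
  push_cast
  field_simp

theorem hasSum_poissonWeight (s : ℝ) : HasSum (poissonWeight s) 1 := by
  have h := (NormedSpace.expSeries_div_hasSum_exp (𝔸 := ℝ) s).mul_left (Real.exp (-s))
  rw [← Real.exp_eq_exp_ℝ, ← Real.exp_add, neg_add_cancel, Real.exp_zero] at h
  exact h

theorem hasSum_mul_poissonWeight (s : ℝ) : HasSum (fun k : ℕ => (k : ℝ) * poissonWeight s k) s := by
  rw [← hasSum_nat_add_iff' 1]
  simp only [succ_mul_poissonWeight]
  simpa using (hasSum_poissonWeight s).mul_left s

theorem hasSum_sq_mul_poissonWeight (s : ℝ) :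
    HasSum (fun k : ℕ => (k : ℝ) ^ 2 * poissonWeight s k) (s ^ 2 + s) := by
  rw [← hasSum_nat_add_iff' 1]
  have h : ∀ k : ℕ, ((k + 1 : ℕ) : ℝ) ^ 2 * poissonWeight s (k + 1)
      = s * ((k : ℝ) * poissonWeight s k) + s * poissonWeight s k := fun k => by
    rw [pow_two, mul_assoc, succ_mul_poissonWeight]
    push_cast
    ring
  simp only [h]
  have := ((hasSum_mul_poissonWeight s).mul_left s).add ((hasSum_poissonWeight s).mul_left s)
  refine hasSum_congr_fun this (fun k => rfl) ?_
  simp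
  ring

theorem hasSum_variance_poissonWeight {s : ℝ} (hs : 0 < s) :
    HasSum (fun k : ℕ => (k / s - 1) ^ 2 * poissonWeight s k) s⁻¹ := by
  have := (((hasSum_sq_mul_poissonWeight s).mul_left (s⁻¹ ^ 2)).sub
    ((hasSum_mul_poissonWeight s).mul_left (2 * s⁻¹))).add (hasSum_poissonWeight s)
  refine hasSum_congr_fun this (fun k => ?_) ?_
  · field_simp
    ring
  · field_simp
    ring

end Poisson

/-! ### Semigroups generated by `Q - 1` for a contraction `Q` -/

section Semigroup

variable {B : Type*} [NormedAddCommGroup B] [NormedSpace ℂ B] [CompleteSpace B]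

/-- `Q` commutes with the identity, so `exp(s(Q-1)) = e^{-s} exp(sQ)`. The index `k` is the number
of collisions up to time `s`. -/
theorem hasSum_expSemigroup (Q : B →L[ℂ] B) (s : ℝ) :
    HasSum (fun k : ℕ => ((poissonWeight s k : ℝ) : ℂ) • Q ^ k) (expSemigroup (Q - 1) s) := by
  have h1 : expSemigroup (Q - 1) s
      = (Real.exp (-s) : ℂ) • NormedSpace.exp ((s : ℂ) • Q) := by
    have hc : Commute ((s : ℂ) • Q) ((-(s : ℂ)) • (1 : B →L[ℂ] B)) :=
      ((Commute.one_right Q).smul_left _).smul_right _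
    have he : NormedSpace.exp ((-(s : ℂ)) • (1 : B →L[ℂ] B)) = (Real.exp (-s) : ℂ) • 1 := by
      rw [← Algebra.algebraMap_eq_smul_one, ← NormedSpace.algebraMap_exp_comm,
        ← Complex.exp_eq_exp_ℂ, Algebra.algebraMap_eq_smul_one]
      push_cast
      rfl
    let _ : NormedAlgebra ℚ (B →L[ℂ] B) := NormedAlgebra.restrictScalars ℚ ℂ _
    rw [expSemigroup, smul_sub, sub_eq_add_neg, ← neg_smul, NormedSpace.exp_add_of_commute hc, he]
    simp
  rw [h1]
  have h2 := (NormedSpace.exp_series_hasSum_exp' (𝕂 := ℂ) ((s : ℂ) • Q)).const_smul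
    (Real.exp (-s) : ℂ)
  refine hasSum_congr_fun h2 (fun k => ?_) rfl
  rw [smul_pow, smul_smul, smul_smul, poissonWeight]
  push_cast
  congr 1
  ring

theorem hasSum_expSemigroup_apply (Q : B →L[ℂ] B) (s : ℝ) (x : B) :
    HasSum (fun k : ℕ => ((poissonWeight s k : ℝ) : ℂ) • (Q ^ k) x) (expSemigroup (Q - 1) s x) := by
  have h := (ContinuousLinearMap.apply ℂ B x).hasSum (hasSum_expSemigroup Q s)
  exact h

theorem norm_pow_le_one {Q : B →L[ℂ] B} (hQ : ‖Q‖ ≤ 1) (k : ℕ) : ‖Q ^ k‖ ≤ 1 := by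
  induction k with
  | zero => exact ContinuousLinearMap.norm_id_le (𝕜 := ℂ) (E := B)
  | succ k ih =>
    rw [pow_succ]
    exact (norm_mul_le _ _).trans (mul_le_one₀ ih (norm_nonneg _) hQ)

theorem norm_expSemigroup_le {Q : B →L[ℂ] B} (hQ : ‖Q‖ ≤ 1) {s : ℝ} (hs : 0 ≤ s) :
    ‖expSemigroup (Q - 1) s‖ ≤ 1 := by
  rw [← (hasSum_expSemigroup Q s).tsum_eq]
  refine tsum_of_norm_bounded (hasSum_poissonWeight s) fun k => ?_
  rw [norm_smul, Complex.norm_real, Real.norm_of_nonneg (poissonWeight_nonneg hs k)]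
  exact mul_le_of_le_one_right (poissonWeight_nonneg hs k) (norm_pow_le_one hQ k)

/-- The semigroup generated by `Q - 1`, where `Q` is a contraction, is asymptotically constant. -/
theorem norm_expSemigroup_mul_le {Q : B →L[ℂ] B} (hQ : ‖Q‖ ≤ 1) {s : ℝ} (hs : 0 < s) :
    ‖expSemigroup (Q - 1) s * (Q - 1)‖ ≤ (√s)⁻¹ := by
  -- Multiplication by `Q` shifts the weights, and size-biasing turns the weight at `k - 1` into `k
  -- / s` times the weight at `k`; the term `k = 0` vanishes.
  have h1 : HasSum (fun k : ℕ => ((k / s * poissonWeight s k : ℝ) : ℂ) • Q ^ k)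
      (expSemigroup (Q - 1) s * Q) := by
    rw [← hasSum_nat_add_iff' 1]
    have h := (hasSum_expSemigroup Q s).mul_right Q
    refine hasSum_congr_fun h (fun k => ?_) ?_
    · have h3 : ((k + 1 : ℕ) : ℝ) / s * poissonWeight s (k + 1) = poissonWeight s k := by
        rw [div_mul_eq_mul_div, succ_mul_poissonWeight, mul_div_cancel_left₀ _ hs.ne']
      rw [h3, smul_mul_assoc, pow_succ]
    · simp
  have h2 := h1.sub (hasSum_expSemigroup Q s)
  have h3 : expSemigroup (Q - 1) s * Q - expSemigroup (Q - 1) s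
      = expSemigroup (Q - 1) s * (Q - 1) := by
    rw [mul_sub, mul_one]
  rw [h3] at h2
  have hr : 0 < √s := Real.sqrt_pos.2 hs
  -- Majorant from `|x| ≤ (√s)⁻¹/2 + (√s/2) x²` with `x = k/s - 1`. As the variance of `k/s` is
  -- `s⁻¹`, each half contributes `(√s)⁻¹/2`.
  have h4 : HasSum (fun k : ℕ => (√s)⁻¹ / 2 * poissonWeight s k
      + √s / 2 * ((k / s - 1) ^ 2 * poissonWeight s k)) (√s)⁻¹ := by
    have := ((hasSum_poissonWeight s).mul_left ((√s)⁻¹ / 2)).add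
      ((hasSum_variance_poissonWeight hs).mul_left (√s / 2))
    refine hasSum_congr_fun this (fun k => rfl) ?_
    nth_rewrite 4 [← Real.mul_self_sqrt hs.le]
    field_simp
    norm_num
  rw [← h2.tsum_eq]
  refine tsum_of_norm_bounded h4 fun k => ?_
  rw [← sub_smul, norm_smul, ← Complex.ofReal_sub, Complex.norm_real, Real.norm_eq_abs]
  have hp := poissonWeight_nonneg hs.le k
  refine (mul_le_of_le_one_right (abs_nonneg _) (norm_pow_le_one hQ k)).trans ?_
  have h5 : k / s * poissonWeight s k - poissonWeight s k = (k / s - 1) * poissonWeight s k := by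
    ring
  rw [h5, abs_mul, abs_of_nonneg hp, ← mul_assoc, ← add_mul]
  refine mul_le_mul_of_nonneg_right ?_ hp
  set x := (k : ℝ) / s - 1
  have h6 : 0 ≤ (√s)⁻¹ / 2 * (1 - √s * |x|) ^ 2 := by positivity
  have h7 : (√s)⁻¹ / 2 * (1 - √s * |x|) ^ 2 = (√s)⁻¹ / 2 + √s / 2 * x ^ 2 - |x| := by
    rw [← sq_abs x]
    field_simp
    ring
  linarith

theorem tendsto_expSemigroup_mul {Q : B →L[ℂ] B} (hQ : ‖Q‖ ≤ 1) (x : B) :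
    Tendsto (fun s : ℝ => expSemigroup (Q - 1) s ((Q - 1) x)) atTop (𝓝 0) := by
  have h0 : Tendsto (fun s : ℝ => (√s)⁻¹ * ‖x‖) atTop (𝓝 0) := by
    simpa using (tendsto_inv_atTop_zero.comp Real.tendsto_sqrt_atTop).mul_const ‖x‖
  refine squeeze_zero_norm' ?_ h0
  filter_upwards [eventually_gt_atTop 0] with s hs
  exact (expSemigroup (Q - 1) s * (Q - 1)).le_of_opNorm_le (norm_expSemigroup_mul_le hQ hs) x

theorem pow_apply_of_fixed {Q : B →L[ℂ] B} {x : B} (hx : Q x = x) (k : ℕ) : (Q ^ k) x = x := by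
  induction k with
  | zero => simp
  | succ k ih => rw [pow_succ, mul_apply_eq_comp, hx, ih]

/-- A continuous linear map which is invariant under `Q` is invariant under the semigroup
generated by `Q - 1`. -/
theorem map_expSemigroup {E : Type*} [NormedAddCommGroup E] [NormedSpace ℂ E] {Q : B →L[ℂ] B}
    (φ : B →L[ℂ] E) (hφ : ∀ x, φ (Q x) = φ x) (s : ℝ) (x : B) :
    φ (expSemigroup (Q - 1) s x) = φ x := by
  have h := φ.hasSum (hasSum_expSemigroup_apply Q s x)
  have hk : ∀ k : ℕ, φ ((Q ^ k) x) = φ x := fun k => by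
    induction k with
    | zero => simp
    | succ k ih => rw [pow_succ', mul_apply_eq_comp, hφ, ih]
  have h1 : HasSum (fun k : ℕ => ((poissonWeight s k : ℝ) : ℂ)) 1 := by
    exact_mod_cast Complex.ofRealCLM.hasSum (hasSum_poissonWeight s)
  have h2 := h1.smul_const (φ x)
  rw [one_smul] at h2
  refine h.unique ?_
  refine hasSum_congr_fun h2 (fun k => ?_) rfl
  rw [map_smul, hk]

theorem expSemigroup_of_fixed {Q : B →L[ℂ] B} {x : B} (hx : Q x = x) (s : ℝ) :
    expSemigroup (Q - 1) s x = x := by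
  have h := hasSum_expSemigroup_apply Q s x
  simp only [pow_apply_of_fixed hx] at h
  have h1 : HasSum (fun k : ℕ => ((poissonWeight s k : ℝ) : ℂ)) 1 := by
    exact_mod_cast Complex.ofRealCLM.hasSum (hasSum_poissonWeight s)
  have h2 := h1.smul_const x
  rw [one_smul] at h2
  exact h.unique h2

/-- A closed convex cone which is invariant under `Q` is invariant under the semigroup generated
by `Q - 1`. -/
theorem expSemigroup_mem {Q : B →L[ℂ] B} {P : Set B} (hP : IsClosed P) (h0 : (0 : B) ∈ P)
    (hadd : ∀ x ∈ P, ∀ y ∈ P, x + y ∈ P) (hsmul : ∀ c : ℝ, 0 ≤ c → ∀ x ∈ P, (c : ℂ) • x ∈ P)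
    (hQ : ∀ x ∈ P, Q x ∈ P) {s : ℝ} (hs : 0 ≤ s) {x : B} (hx : x ∈ P) :
    expSemigroup (Q - 1) s x ∈ P := by
  have hk : ∀ k : ℕ, (Q ^ k) x ∈ P := fun k => by
    induction k with
    | zero => simpa
    | succ k ih =>
      rw [pow_succ', mul_apply_eq_comp]
      exact hQ _ ih
  refine hP.mem_of_tendsto (hasSum_expSemigroup_apply Q s x) (Eventually.of_forall fun F => ?_)
  refine Finset.sum_induction _ (· ∈ P) (fun x y hx hy => hadd x hx y hy) h0 fun k _ => ?_
  exact hsmul _ (poissonWeight_nonneg hs k) _ (hk k)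

/-- Mean ergodic decomposition. If `v = (Q-1)y` is fixed by `Q`, then `Q^n y = y + n v`, which stays
bounded only if `v = 0`. So kernel and range of `Q-1` on `V` are disjoint, hence complementary by
rank–nullity. -/
theorem exists_eq_add_of_finiteDimensional {Q : B →L[ℂ] B} (hQ : ‖Q‖ ≤ 1) (V : Submodule ℂ B)
    [FiniteDimensional ℂ V] (hV : ∀ x ∈ V, Q x ∈ V) {x : B} (hx : x ∈ V) :
    ∃ x₀ y : B, Q x₀ = x₀ ∧ x = x₀ + (Q - 1) y := by
  let q : V →ₗ[ℂ] V := (Q : B →ₗ[ℂ] B).restrict hV - 1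
  have hq : ∀ v : V, (q v : B) = (Q - 1) v := fun v => rfl
  have hd : Disjoint (LinearMap.ker q) (LinearMap.range q) := by
    rw [Submodule.disjoint_def]
    rintro _ hz ⟨y, rfl⟩
    have hz' : Q (q y : B) = q y := by
      have := congrArg (Subtype.val) (LinearMap.mem_ker.1 hz)
      rw [hq] at this
      simpa [sub_eq_zero] using this
    have hn : ∀ n : ℕ, (Q ^ n) (y : B) = y + (n : ℂ) • (q y : B) := fun n => by
      induction n with
      | zero => simp
      | succ n ih =>
        have h1 : Q (y : B) = y + q y := by rw [hq]; simp
        rw [pow_succ', mul_apply_eq_comp, ih, map_add, map_smul, hz', h1]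
        push_cast
        module
    have hb : ∀ n : ℕ, (n : ℝ) * ‖(q y : B)‖ ≤ 2 * ‖(y : B)‖ := fun n => by
      have h2 : (n : ℂ) • (q y : B) = (Q ^ n) (y : B) - y := by rw [hn]; abel
      have h3 : ‖(n : ℂ) • (q y : B)‖ = n * ‖(q y : B)‖ := by rw [norm_smul]; simp
      rw [← h3, h2]
      have h4 := (Q ^ n).le_of_opNorm_le (norm_pow_le_one hQ n) (y : B)
      have h5 := norm_sub_le ((Q ^ n) (y : B)) y
      linarith
    have h0 : ‖(q y : B)‖ = 0 := by
      by_contra hne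
      have hpos : 0 < ‖(q y : B)‖ := lt_of_le_of_ne (norm_nonneg _) (Ne.symm hne)
      obtain ⟨n, hn'⟩ := exists_nat_gt (2 * ‖(y : B)‖ / ‖(q y : B)‖)
      rw [div_lt_iff₀ hpos] at hn'
      exact absurd (hb n) (not_le.2 hn')
    exact Subtype.ext (norm_eq_zero.1 h0)
  have hsup : LinearMap.ker q ⊔ LinearMap.range q = ⊤ := by
    refine Submodule.eq_top_of_disjoint _ _ ?_ hd
    rw [add_comm, LinearMap.finrank_range_add_finrank_ker]
  obtain ⟨a, ha, b, ⟨y, rfl⟩, hab⟩ := Submodule.mem_sup.1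
    (hsup ▸ Submodule.mem_top : (⟨x, hx⟩ : V) ∈ LinearMap.ker q ⊔ LinearMap.range q)
  refine ⟨a, y, ?_, ?_⟩
  · have := congrArg (Subtype.val) (LinearMap.mem_ker.1 ha)
    rw [hq] at this
    simpa [sub_eq_zero] using this
  · rw [← hq]
    exact (congrArg Subtype.val hab).symm

/-- If `Q` is a contraction and `x` is a limit of vectors in finite-dimensional `Q`-invariant
subspaces, then the semigroup generated by `Q - 1` takes `x` to a fixed point of `Q`. -/
theorem exists_tendsto_expSemigroup {Q : B →L[ℂ] B} (hQ : ‖Q‖ ≤ 1) {x : B}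
    (hx : ∀ ε : ℝ, 0 < ε → ∃ V : Submodule ℂ B, FiniteDimensional ℂ V ∧ (∀ y ∈ V, Q y ∈ V) ∧
      ∃ y ∈ V, ‖x - y‖ < ε) :
    ∃ z : B, Q z = z ∧ Tendsto (fun s : ℝ => expSemigroup (Q - 1) s x) atTop (𝓝 z) := by
  have hc : CauchySeq fun s : ℝ => expSemigroup (Q - 1) s x := by
    rw [Metric.cauchySeq_iff']
    intro ε hε
    obtain ⟨V, hfin, hV, y, hy, hxy⟩ := hx (ε / 6) (by positivity)
    obtain ⟨y₀, w, hy₀, rfl⟩ := exists_eq_add_of_finiteDimensional hQ V hV hy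
    have ht : ∀ᶠ s : ℝ in atTop, ‖expSemigroup (Q - 1) s ((Q - 1) w)‖ < ε / 6 :=
      (tendsto_expSemigroup_mul hQ w).norm.eventually_lt_const (by simpa using by positivity)
    obtain ⟨s₀, hs₀⟩ := (ht.and (eventually_ge_atTop 0)).exists_forall_of_atTop
    -- The approximation error is contracted and the range part decays, so the orbit comes within
    -- `ε/6 + ε/6` of the fixed part `y₀`.
    have key : ∀ s ≥ s₀, dist (expSemigroup (Q - 1) s x) y₀ < ε / 2 := fun s hs => by
      obtain ⟨h1, h2⟩ := hs₀ s hs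
      have h3 : expSemigroup (Q - 1) s x - y₀
          = expSemigroup (Q - 1) s (x - (y₀ + (Q - 1) w))
            + expSemigroup (Q - 1) s ((Q - 1) w) := by
        rw [← map_add, sub_add_eq_sub_sub, sub_add_cancel, map_sub, expSemigroup_of_fixed hy₀]
      rw [dist_eq_norm, h3]
      have h4 := (expSemigroup (Q - 1) s).le_of_opNorm_le (norm_expSemigroup_le hQ h2)
        (x - (y₀ + (Q - 1) w))
      have h5 := norm_add_le (expSemigroup (Q - 1) s (x - (y₀ + (Q - 1) w)))
        (expSemigroup (Q - 1) s ((Q - 1) w))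
      linarith
    refine ⟨s₀, fun s hs => ?_⟩
    have := dist_triangle_right (expSemigroup (Q - 1) s x) (expSemigroup (Q - 1) s₀ x) y₀
    have h1 := key s hs
    have h2 := key s₀ le_rfl
    linarith
  obtain ⟨z, hz⟩ := cauchySeq_tendsto_of_complete hc
  refine ⟨z, ?_, hz⟩
  -- The limit is fixed because `Q - 1` commutes with the semigroup and the semigroup tends to zero
  -- on the range of `Q - 1`.
  have hcomm : ∀ s : ℝ, (Q - 1) (expSemigroup (Q - 1) s x) = expSemigroup (Q - 1) s ((Q - 1) x) :=
    fun s => by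
      have : Commute (Q - 1) (expSemigroup (Q - 1) s) :=
        ((Commute.refl (Q - 1)).smul_right (s : ℂ)).exp_right
      exact congrArg (fun T : B →L[ℂ] B => T x) this.eq
  have h1 : Tendsto (fun s : ℝ => (Q - 1) (expSemigroup (Q - 1) s x)) atTop (𝓝 ((Q - 1) z)) :=
    ((Q - 1).continuous.tendsto z).comp hz
  simp only [hcomm] at h1
  have h2 := tendsto_nhds_unique h1 (tendsto_expSemigroup_mul hQ x)
  simpa [sub_eq_zero] using h2

end Semigroup

/-! ### Trace norm estimates through quadratic forms -/

section TraceNorm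

variable {K : Type*} [NormedAddCommGroup K] [InnerProductSpace ℂ K] [CompleteSpace K]

theorem inner_selfAdjoint {A : K →L[ℂ] K} (hA : IsSelfAdjoint A) (x y : K) :
    ⟪A x, y⟫_ℂ = ⟪x, A y⟫_ℂ :=
  ContinuousLinearMap.isSelfAdjoint_iff_isSymmetric.1 hA x y

/-- A vector which is orthogonal to a Hilbert basis of a closed subspace is orthogonal to it. -/
theorem mem_orthogonal_of_hilbertBasis {ι : Type*} {M : Submodule ℂ K} (b : HilbertBasis ι ℂ M)
    {v : K} (hv : ∀ i, ⟪(b i : K), v⟫_ℂ = 0) : v ∈ Mᗮ := by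
  rw [Submodule.mem_orthogonal']
  intro m hm
  have h1 := M.subtypeL.hasSum (b.hasSum_repr ⟨m, hm⟩)
  have h2 := (innerSL ℂ v).hasSum h1
  refine h2.unique (hasSum_congr_fun hasSum_zero (fun i => ?_) rfl)
  have h3 : ⟪v, (b i : K)⟫_ℂ = 0 := by rw [← inner_conj_symm, hv, map_zero]
  simp [h3]

/-- There is a Hilbert basis consisting of vectors in a closed subspace and of vectors orthogonal
to it. -/
theorem exists_hilbertBasis_adapted (M : Submodule ℂ K) [CompleteSpace M] :
    ∃ (w : Set K) (b : HilbertBasis w ℂ K), ∀ i, b i ∈ M ∨ b i ∈ Mᗮ := by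
  have hinj : Function.Injective fun i => (onb M i : K) := fun i j hij => by
    exact (onb M).orthonormal.linearIndependent.injective (Subtype.ext hij)
  have ho : Orthonormal ℂ fun i => (onb M i : K) :=
    (onb M).orthonormal.comp_linearIsometry M.subtypeₗᵢ
  obtain ⟨w, b, hw, hb⟩ := ho.toSubtypeRange.exists_hilbertBasis_extension
  refine ⟨w, b, fun v => ?_⟩
  by_cases hv : b v ∈ Set.range fun i => (onb M i : K)
  · obtain ⟨i, hi⟩ := hv
    left
    rw [← hi]
    exact (onb M i).2
  · right
    refine mem_orthogonal_of_hilbertBasis (onb M) fun i => ?_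
    have hi : (onb M i : K) ∈ w := hw ⟨i, rfl⟩
    have h1 : (onb M i : K) = b ⟨_, hi⟩ := by rw [hb]
    rw [h1]
    refine b.orthonormal.2 fun hne => hv ?_
    rw [← hne, ← h1]
    exact ⟨i, rfl⟩

/-- In an orthonormal basis each of whose vectors is annihilated by `A⁺` or by `A⁻`, the diagonal
entries of `|A|` are the absolute values of those of `A`. This reduces trace norm bounds to bounds
of quadratic forms. -/
theorem traceNorm_le_posTrace {A G : K →L[ℂ] K} (hA : IsSelfAdjoint A) (hG : G.IsPositive)
    (h : ∀ v, |RCLike.re ⟪v, A v⟫_ℂ| ≤ RCLike.re ⟪v, G v⟫_ℂ) : traceNorm A ≤ posTrace G := by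
  have hsub : A⁺ - A⁻ = A := CFC.posPart_sub_negPart A hA
  have hadd : A⁺ + A⁻ = CFC.abs A := CFC.posPart_add_negPart A hA
  have hmul : A⁺ * A⁻ = 0 := CFC.posPart_mul_negPart A
  have hn : IsSelfAdjoint A⁻ := (CFC.negPart_nonneg A).isSelfAdjoint
  have habs : (CFC.abs A).IsPositive :=
    (ContinuousLinearMap.nonneg_iff_isPositive _).1 (CFC.abs_nonneg A)
  -- The kernel of `A⁺` contains the range of `A⁻`, since `A⁺ A⁻ = 0`; therefore `A⁻` vanishes on
  -- its orthogonal complement.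
  let M : Submodule ℂ K := LinearMap.ker (A⁺ : K →L[ℂ] K).toLinearMap
  have hM : IsClosed (M : Set K) := ContinuousLinearMap.isClosed_ker A⁺
  have : CompleteSpace M := hM.completeSpace_coe
  obtain ⟨w, b, hb⟩ := exists_hilbertBasis_adapted M
  rw [traceNorm, posTrace_eq b habs, posTrace_eq b hG]
  refine ENNReal.tsum_le_tsum fun i => ENNReal.ofReal_le_ofReal ((le_trans ?_) (h (b i)))
  rw [← hadd]
  rcases hb i with hi | hi
  · have h0 : A⁺ (b i) = 0 := hi
    have h1 : A (b i) = -(A⁻ (b i)) := by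
      conv_lhs => rw [← hsub]
      simp [h0]
    rw [h1, inner_neg_right, map_neg, abs_neg, add_apply, h0, zero_add]
    exact le_abs_self _
  · have h0 : A⁻ (b i) = 0 := by
      refine ext_inner_left ℂ fun x => ?_
      rw [← inner_selfAdjoint hn, inner_zero_right]
      refine Submodule.inner_right_of_mem_orthogonal (K := M) ?_ hi
      exact congrArg (fun T : K →L[ℂ] K => T x) hmul
    have h1 : A (b i) = A⁺ (b i) := by
      conv_lhs => rw [← hsub]
      simp [h0]
    rw [h1, add_apply, h0, add_zero]
    exact le_abs_self _

theorem posTrace_add {A B : K →L[ℂ] K} (hA : A.IsPositive) (hB : B.IsPositive) :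
    posTrace (A + B) = posTrace A + posTrace B := by
  rw [posTrace, posTrace, posTrace, ← ENNReal.tsum_add]
  refine tsum_congr fun j => ?_
  rw [add_apply, inner_add_right, map_add,
    ENNReal.ofReal_add (hA.re_inner_nonneg_right _) (hB.re_inner_nonneg_right _)]

theorem posTrace_smul {c : ℝ} (hc : 0 ≤ c) (A : K →L[ℂ] K) :
    posTrace ((c : ℂ) • A) = ENNReal.ofReal c * posTrace A := by
  rw [posTrace, posTrace, ← ENNReal.tsum_mul_left]
  refine tsum_congr fun j => ?_
  rw [← ENNReal.ofReal_mul hc, smul_apply, inner_smul_right]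
  congr 1
  exact Complex.re_ofReal_mul _ _

theorem isPositive_smul {A : K →L[ℂ] K} (hA : A.IsPositive) {c : ℝ} (hc : 0 ≤ c) :
    ((c : ℂ) • A).IsPositive := hA.smul_of_nonneg (by exact_mod_cast hc)

/-- A unit vector can be completed to an orthonormal basis, and its diagonal entry is then one term
of the trace. -/
theorem re_inner_le_of_posTrace_le {A : K →L[ℂ] K} (hA : A.IsPositive) {c : ℝ} (hc : 0 ≤ c)
    (h : posTrace A ≤ ENNReal.ofReal c) (v : K) : RCLike.re ⟪v, A v⟫_ℂ ≤ c * ‖v‖ ^ 2 := by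
  have key : ∀ u : K, ‖u‖ = 1 → RCLike.re ⟪u, A u⟫_ℂ ≤ c := fun u hu => by
    have ho : Orthonormal ℂ ((↑) : ({u} : Set K) → K) := by
      refine ⟨fun x => by rw [x.2, hu], fun x y hxy => (hxy (Subsingleton.elim x y)).elim⟩
    obtain ⟨w, b, hw, hb⟩ := ho.exists_hilbertBasis_extension
    rw [posTrace_eq b hA] at h
    have h1 := (ENNReal.le_tsum (⟨u, hw rfl⟩ : w)).trans h
    rw [hb, ENNReal.ofReal_le_ofReal_iff hc] at h1
    exact h1
  rcases eq_or_ne v 0 with rfl | hv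
  · simp
  have hn : (0 : ℝ) < ‖v‖ := norm_pos_iff.2 hv
  have h1 := key (((‖v‖⁻¹ : ℝ) : ℂ) • v) (by
    rw [norm_smul, Complex.norm_real, norm_inv, norm_norm, inv_mul_cancel₀ hn.ne'])
  rw [map_smul, inner_smul_left, inner_smul_right, Complex.conj_ofReal, ← mul_assoc,
    ← Complex.ofReal_mul] at h1
  have h2 : RCLike.re (((‖v‖⁻¹ * ‖v‖⁻¹ : ℝ) : ℂ) * ⟪v, A v⟫_ℂ)
      = ‖v‖⁻¹ * ‖v‖⁻¹ * RCLike.re ⟪v, A v⟫_ℂ := Complex.re_ofReal_mul _ _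
  rw [h2, ← mul_inv, inv_mul_le_iff₀ (by positivity)] at h1
  linarith

theorem norm_le_of_abs_re_inner_le {A : K →L[ℂ] K} (hA : IsSelfAdjoint A) {c : ℝ} (hc : 0 ≤ c)
    (h : ∀ v, |RCLike.re ⟪v, A v⟫_ℂ| ≤ c * ‖v‖ ^ 2) : ‖A‖ ≤ c := by
  rw [ContinuousLinearMap.norm_eq_iSup_rayleighQuotient A
    (ContinuousLinearMap.isSelfAdjoint_iff_isSymmetric.1 hA)]
  refine ciSup_le fun x => ?_
  rw [ContinuousLinearMap.rayleighQuotient, abs_div, abs_of_nonneg (sq_nonneg ‖x‖),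
    ContinuousLinearMap.reApplyInnerSelf_apply, inner_selfAdjoint hA]
  exact div_le_of_le_mul₀ (by positivity) hc (h x)

theorem isPositive_conj {A : K →L[ℂ] K} (hA : A.IsPositive) {P : K →L[ℂ] K}
    (hP : IsSelfAdjoint P) : (P * A * P).IsPositive := by
  have := hA.conj_adjoint P
  rwa [← ContinuousLinearMap.star_eq_adjoint, hP.star_eq] at this

/-- A positive operator which controls `A - P A P`. -/
def compressionBound (δ : ℝ) (P A : K →L[ℂ] K) : K →L[ℂ] K :=
  (δ : ℂ) • (P * A * P) + ((1 + δ⁻¹ : ℝ) : ℂ) • ((1 - P) * A * (1 - P))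

theorem isPositive_compressionBound {δ : ℝ} (hδ : 0 < δ) {A P : K →L[ℂ] K} (hA : A.IsPositive)
    (hP : IsSelfAdjoint P) : (compressionBound δ P A).IsPositive :=
  (isPositive_smul (isPositive_conj hA hP) hδ.le).add
    (isPositive_smul (isPositive_conj hA ((IsSelfAdjoint.one _).sub hP)) (by positivity))

theorem re_inner_conj {A P : K →L[ℂ] K} (hP : IsSelfAdjoint P) (v : K) :
    RCLike.re ⟪v, (P * A * P) v⟫_ℂ = RCLike.re ⟪P v, A (P v)⟫_ℂ := by
  rw [mul_apply_eq_comp, mul_apply_eq_comp, inner_selfAdjoint hP]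

/-- With `x = P v` and `y = (1 - P) v`, the left side is `|⟨y, A y⟩ + 2 Re ⟨x, A y⟩|`. The cross
term is at most `δ ⟨x, A x⟩ + δ⁻¹ ⟨y, A y⟩` by positivity of `A`. -/
theorem abs_re_inner_sub_conj_le {δ : ℝ} (hδ : 0 < δ) {A P : K →L[ℂ] K} (hA : A.IsPositive)
    (hP : IsSelfAdjoint P) (v : K) :
    |RCLike.re ⟪v, (A - P * A * P) v⟫_ℂ| ≤ RCLike.re ⟪v, compressionBound δ P A v⟫_ℂ := by
  have hP' : IsSelfAdjoint (1 - P) := (IsSelfAdjoint.one _).sub hP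
  set x := P v with hx
  set y := (1 - P) v with hy
  have hv : v = x + y := by simp [hx, hy]
  have hG : RCLike.re ⟪v, compressionBound δ P A v⟫_ℂ
      = δ * RCLike.re ⟪x, A x⟫_ℂ + (1 + δ⁻¹) * RCLike.re ⟪y, A y⟫_ℂ := by
    rw [compressionBound, add_apply, inner_add_right, map_add,
      smul_apply, smul_apply, inner_smul_right,
      inner_smul_right, hx, hy, ← re_inner_conj hP, ← re_inner_conj hP']
    congr 1 <;> exact Complex.re_ofReal_mul _ _
  have hs : RCLike.re ⟪y, A x⟫_ℂ = RCLike.re ⟪x, A y⟫_ℂ := by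
    rw [← inner_selfAdjoint hA.isSelfAdjoint, inner_re_symm]
  have hL : RCLike.re ⟪v, (A - P * A * P) v⟫_ℂ
      = RCLike.re ⟪y, A y⟫_ℂ + 2 * RCLike.re ⟪x, A y⟫_ℂ := by
    rw [sub_apply, inner_sub_right, map_sub, re_inner_conj hP, ← hx, hv, map_add,
      inner_add_left, inner_add_right, inner_add_right, map_add, map_add, map_add, hs]
    ring
  -- Positivity at `c x + y`; the choices `c = ±δ` give both signs of the cross term.
  have hq : ∀ c : ℝ, 0 ≤ c ^ 2 * RCLike.re ⟪x, A x⟫_ℂ + 2 * c * RCLike.re ⟪x, A y⟫_ℂ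
      + RCLike.re ⟪y, A y⟫_ℂ := fun c => by
    have := hA.re_inner_nonneg_right ((c : ℂ) • x + y)
    rw [map_add, map_smul, inner_add_left, inner_add_right, inner_add_right, inner_smul_left,
      inner_smul_right, inner_smul_left, inner_smul_right, Complex.conj_ofReal, map_add, map_add,
      map_add] at this
    have e : ∀ z : ℂ, RCLike.re ((c : ℂ) * z) = c * RCLike.re z := fun z =>
      Complex.re_ofReal_mul _ _
    rw [e, e, e, e, hs] at this
    linarith
  have h1 := hq δ
  have h2 := hq (-δ)
  have hy0 := hA.re_inner_nonneg_right y
  rw [hL, hG]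
  set a := RCLike.re ⟪x, A x⟫_ℂ
  set m := RCLike.re ⟪x, A y⟫_ℂ
  set d := RCLike.re ⟪y, A y⟫_ℂ
  have hm : |2 * m| ≤ δ * a + δ⁻¹ * d := by
    have h3 : δ * |2 * m| ≤ δ ^ 2 * a + d := by
      rw [← abs_of_pos hδ, ← abs_mul, abs_of_pos hδ, abs_le]
      constructor <;> linarith
    have h4 : δ * a + δ⁻¹ * d = δ⁻¹ * (δ ^ 2 * a + d) := by field_simp
    rw [h4, le_inv_mul_iff₀ hδ]
    exact h3
  calc |d + 2 * m| ≤ |d| + |2 * m| := abs_add_le _ _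
    _ ≤ _ := by rw [abs_of_nonneg hy0]; linarith

end TraceNorm

/-! ### Finite-rank basis projections and partial traces -/

section BasisProj

variable {K : Type*} [NormedAddCommGroup K] [InnerProductSpace ℂ K] [CompleteSpace K]
  {ι : Type*} (b : HilbertBasis ι ℂ K) (F : Finset ι)

/-- The orthogonal projection onto the span of finitely many vectors of a Hilbert basis. -/
def basisProj : K →L[ℂ] K := ∑ i ∈ F, InnerProductSpace.rankOne ℂ (b i) (b i)

theorem basisProj_apply (x : K) : basisProj b F x = ∑ i ∈ F, ⟪b i, x⟫_ℂ • b i := by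
  simp [basisProj]

theorem inner_basis [DecidableEq ι] (i j : ι) : ⟪b i, b j⟫_ℂ = if i = j then 1 else 0 :=
  orthonormal_iff_ite.1 b.orthonormal i j

theorem basisProj_basis_of_mem {i : ι} (hi : i ∈ F) : basisProj b F (b i) = b i := by
  classical
  rw [basisProj_apply]
  simp [inner_basis, hi]

theorem basisProj_basis_of_notMem {i : ι} (hi : i ∉ F) : basisProj b F (b i) = 0 := by
  classical
  rw [basisProj_apply]
  simp [inner_basis, hi]

theorem ext_hilbertBasis {E : Type*} [NormedAddCommGroup E] [NormedSpace ℂ E] {A B : K →L[ℂ] E}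
    (h : ∀ i, A (b i) = B (b i)) : A = B := by
  refine ContinuousLinearMap.ext_on
    (Submodule.dense_iff_topologicalClosure_eq_top.2 b.dense_span) ?_
  rintro _ ⟨i, rfl⟩
  exact h i

theorem ext_inner_hilbertBasis {x y : K} (h : ∀ i, ⟪b i, x⟫_ℂ = ⟪b i, y⟫_ℂ) : x = y := by
  refine b.repr.injective ?_
  ext i
  rw [b.repr_apply_apply, b.repr_apply_apply, h]

theorem isSelfAdjoint_basisProj : IsSelfAdjoint (basisProj b F) := by
  rw [ContinuousLinearMap.isSelfAdjoint_iff_isSymmetric]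
  intro x y
  simp only [ContinuousLinearMap.coe_coe, basisProj_apply, sum_inner, inner_sum, inner_smul_left,
    inner_smul_right, inner_conj_symm]
  exact Finset.sum_congr rfl fun i _ => mul_comm _ _

theorem basisProj_mul_self : basisProj b F * basisProj b F = basisProj b F := by
  refine ext_hilbertBasis b fun i => ?_
  by_cases hi : i ∈ F
  · simp [basisProj_basis_of_mem b F hi]
  · simp [basisProj_basis_of_notMem b F hi]

theorem commute_basisProj {W : K →L[ℂ] K}
    (hW : ∀ i j, (i ∈ F ∧ j ∉ F ∨ i ∉ F ∧ j ∈ F) → ⟪b i, W (b j)⟫_ℂ = 0) :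
    Commute W (basisProj b F) := by
  refine ext_hilbertBasis b fun j => ext_inner_hilbertBasis b fun i => ?_
  rw [mul_apply_eq_comp, mul_apply_eq_comp, ← inner_selfAdjoint (isSelfAdjoint_basisProj b F)]
  by_cases hi : i ∈ F <;> by_cases hj : j ∈ F
  · rw [basisProj_basis_of_mem b F hi, basisProj_basis_of_mem b F hj]
  · rw [basisProj_basis_of_mem b F hi, basisProj_basis_of_notMem b F hj, hW i j (Or.inl ⟨hi, hj⟩)]
    simp
  · rw [basisProj_basis_of_notMem b F hi, basisProj_basis_of_mem b F hj, hW i j (Or.inr ⟨hi, hj⟩)]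
    simp
  · rw [basisProj_basis_of_notMem b F hi, basisProj_basis_of_notMem b F hj]
    simp

/-- The trace of the compression of an operator to the span of finitely many basis vectors. -/
def basisTrace : (K →L[ℂ] K) →L[ℂ] ℂ :=
  ∑ i ∈ F, (innerSL ℂ (b i)).comp (ContinuousLinearMap.apply ℂ K (b i))

theorem basisTrace_apply (A : K →L[ℂ] K) : basisTrace b F A = ∑ i ∈ F, ⟪b i, A (b i)⟫_ℂ := by
  simp [basisTrace]

/-- Both `W` and `W*` preserve the span of the `b i` with `i ∈ F`, so this is the unitary invariance
of a finite-dimensional trace. It is carried out in coordinates by expanding `W* b i` and `b j` and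
exchanging the sums. -/
theorem basisTrace_conj (A : K →L[ℂ] K) {W : K →L[ℂ] K} (hW : W ∈ unitary (K →L[ℂ] K))
    (hc : Commute W (basisProj b F)) : basisTrace b F (W * A * star W) = basisTrace b F A := by
  have hc' : Commute (star W) (basisProj b F) := by
    have := hc.star_star
    rwa [(isSelfAdjoint_basisProj b F).star_eq] at this
  have h1 : ∀ i ∈ F, star W (b i) = ∑ j ∈ F, ⟪b j, star W (b i)⟫_ℂ • b j := fun i hi => by
    rw [← basisProj_apply]
    conv_lhs => rw [← basisProj_basis_of_mem b F hi]
    exact congrArg (fun T : K →L[ℂ] K => T (b i)) hc'.eq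
  have h2 : ∀ i ∈ F, W (b i) = ∑ j ∈ F, ⟪b j, W (b i)⟫_ℂ • b j := fun i hi => by
    rw [← basisProj_apply]
    conv_lhs => rw [← basisProj_basis_of_mem b F hi]
    exact congrArg (fun T : K →L[ℂ] K => T (b i)) hc.eq
  have hadj : ∀ i j, ⟪b j, star W (b i)⟫_ℂ = starRingEnd ℂ ⟪b i, W (b j)⟫_ℂ := fun i j => by
    rw [ContinuousLinearMap.star_eq_adjoint, ContinuousLinearMap.adjoint_inner_right,
      inner_conj_symm]
  rw [basisTrace_apply, basisTrace_apply]
  calc _ = ∑ i ∈ F, ∑ j ∈ F, ⟪b j, star W (b i)⟫_ℂ * ⟪star W (b i), A (b j)⟫_ℂ := by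
        refine Finset.sum_congr rfl fun i hi => ?_
        rw [mul_apply_eq_comp, mul_apply_eq_comp, ← ContinuousLinearMap.adjoint_inner_left,
          ← ContinuousLinearMap.star_eq_adjoint]
        have h4 : A (star W (b i)) = ∑ j ∈ F, ⟪b j, star W (b i)⟫_ℂ • A (b j) := by
          conv_lhs => rw [h1 i hi]
          simp only [map_sum, map_smul]
        rw [h4, inner_sum]
        simp only [inner_smul_right]
    _ = ∑ j ∈ F, ⟪b j, A (b j)⟫_ℂ := by
        rw [Finset.sum_comm]
        refine Finset.sum_congr rfl fun j hj => ?_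
        have h3 : b j = ∑ i ∈ F, ⟪b i, W (b j)⟫_ℂ • star W (b i) := by
          have : star W (W (b j)) = b j := by
            rw [← mul_apply_eq_comp, Unitary.star_mul_self_of_mem hW]
            rfl
          rw [← this]
          conv_lhs => rw [h2 j hj]
          rw [map_sum, this]
          simp only [map_smul]
        have h4 : ∀ x, ⟪b j, x⟫_ℂ = ∑ i ∈ F, ⟪b j, star W (b i)⟫_ℂ * ⟪star W (b i), x⟫_ℂ := fun x => by
          conv_lhs => rw [h3]
          rw [sum_inner]
          simp only [inner_smul_left, hadj]
        exact (h4 _).symm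

theorem posTrace_conj_basisProj {A : K →L[ℂ] K} (hA : A.IsPositive) :
    posTrace (basisProj b F * A * basisProj b F) = ENNReal.ofReal (RCLike.re (basisTrace b F A)) := by
  have hP := isSelfAdjoint_basisProj b F
  rw [posTrace_eq b (isPositive_conj hA hP), basisTrace_apply, map_sum,
    ENNReal.ofReal_sum_of_nonneg (fun i _ => hA.re_inner_nonneg_right _)]
  rw [tsum_eq_sum (s := F) fun i hi => ?_]
  · refine Finset.sum_congr rfl fun i hi => ?_
    rw [re_inner_conj hP, basisProj_basis_of_mem b F hi]
  · rw [re_inner_conj hP, basisProj_basis_of_notMem b F hi]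
    simp

/-- Each vector of `b` is either fixed or annihilated by the projection, so the off-diagonal corners
do not contribute to the trace. -/
theorem posTrace_eq_add {A : K →L[ℂ] K} (hA : A.IsPositive) :
    posTrace A = posTrace (basisProj b F * A * basisProj b F)
      + posTrace ((1 - basisProj b F) * A * (1 - basisProj b F)) := by
  have hP := isSelfAdjoint_basisProj b F
  have hP' : IsSelfAdjoint (1 - basisProj b F) := (IsSelfAdjoint.one _).sub hP
  rw [posTrace_eq b hA, posTrace_eq b (isPositive_conj hA hP),
    posTrace_eq b (isPositive_conj hA hP'), ← ENNReal.tsum_add]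
  refine tsum_congr fun i => ?_
  rw [re_inner_conj hP, re_inner_conj hP']
  by_cases hi : i ∈ F
  · simp [basisProj_basis_of_mem b F hi]
  · simp [basisProj_basis_of_notMem b F hi]

theorem posTrace_basisProj : posTrace (basisProj b F) = F.card := by
  have h := posTrace_conj_basisProj b F (ContinuousLinearMap.isPositive_one (E := K) (𝕜 := ℂ))
  rw [mul_one, basisProj_mul_self, basisTrace_apply] at h
  rw [h]
  simp [b.orthonormal.1]

/-- The trace of a positive operator is the supremum of its partial traces. -/
theorem exists_finset_lt_basisTrace {A : K →L[ℂ] K} (hA : IsDensity A) {ε : ℝ} (hε : 0 < ε) :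
    ∃ F₀ : Finset ι, ∀ F, F₀ ⊆ F → 1 - ε < RCLike.re (basisTrace b F A) := by
  have h := hA.2
  rw [posTrace_eq b hA.1] at h
  have h1 := ENNReal.summable.hasSum (f := fun j => ENNReal.ofReal (RCLike.re ⟪b j, A (b j)⟫_ℂ))
  rw [h] at h1
  have h2 : ∀ᶠ F : Finset ι in atTop, ENNReal.ofReal (1 - ε)
      < ∑ j ∈ F, ENNReal.ofReal (RCLike.re ⟪b j, A (b j)⟫_ℂ) :=
    h1.eventually_const_lt (by
      rw [ENNReal.ofReal_lt_one]
      linarith)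
  obtain ⟨F₀, hF₀⟩ := eventually_atTop.1 h2
  refine ⟨F₀, fun F hF => ?_⟩
  have h3 := hF₀ F hF
  rw [← ENNReal.ofReal_sum_of_nonneg (fun i _ => hA.1.re_inner_nonneg_right _), ← map_sum,
    ← basisTrace_apply] at h3
  exact ENNReal.ofReal_lt_ofReal_iff'.1 h3 |>.1

end BasisProj

/-! ### Averages over conjugation by unitaries -/

section Average

variable {K : Type*} [NormedAddCommGroup K] [InnerProductSpace ℂ K] [CompleteSpace K]
  {C : Type*} [TopologicalSpace C] [CompactSpace C] [MeasurableSpace C] [BorelSpace C]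
  {W : C → K →L[ℂ] K} (hW : ∀ σ, W σ ∈ unitary (K →L[ℂ] K))
  (hc : ∀ x, Continuous fun σ => W σ x) (ν : Measure C) [IsProbabilityMeasure ν]

theorem norm_conjAverage_le : ‖conjAverage W hW hc ν‖ ≤ 1 :=
  LinearMap.mkContinuous₂_norm_le _ zero_le_one _

theorem map_conjAverage {E : Type*} [NormedAddCommGroup E] [NormedSpace ℂ E] [CompleteSpace E]
    (φ : K →L[ℂ] E) (A : K →L[ℂ] K) (y : K) :
    φ (conjAverage W hW hc ν A y) = ∫ σ, φ (W σ (A (star (W σ) y))) ∂ν := by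
  rw [conjAverage_apply]
  exact (φ.integral_comp_comm (integrable_conj W hW hc ν A y)).symm

theorem inner_conjAverage (A : K →L[ℂ] K) (x y : K) :
    ⟪x, conjAverage W hW hc ν A y⟫_ℂ = ∫ σ, ⟪x, W σ (A (star (W σ) y))⟫_ℂ ∂ν :=
  map_conjAverage hW hc ν (innerSL ℂ x) A y

theorem inner_conj (V A : K →L[ℂ] K) (x y : K) :
    ⟪x, V (A (star V y))⟫_ℂ = ⟪star V x, A (star V y)⟫_ℂ := by
  rw [ContinuousLinearMap.star_eq_adjoint, ContinuousLinearMap.adjoint_inner_left]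

theorem isPositive_conjAverage {A : K →L[ℂ] K} (hA : A.IsPositive) :
    (conjAverage W hW hc ν A).IsPositive := by
  have h : ∀ x, ⟪x, conjAverage W hW hc ν A x⟫_ℂ
      = ((∫ σ, RCLike.re ⟪star (W σ) x, A (star (W σ) x)⟫_ℂ ∂ν : ℝ) : ℂ) := fun x => by
    rw [inner_conjAverage, ← integral_complex_ofReal]
    refine integral_congr_ae (ae_of_all _ fun σ => ?_)
    dsimp only
    rw [inner_conj]
    refine (Complex.conj_eq_iff_re.1 ?_).symm
    rw [inner_conj_symm, inner_selfAdjoint hA.isSelfAdjoint]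
  rw [ContinuousLinearMap.isPositive_iff_complex]
  intro x
  rw [← inner_conj_symm, h, Complex.conj_ofReal]
  refine ⟨by simp, ?_⟩
  rw [RCLike.re_eq_complex_re, Complex.ofReal_re]
  exact integral_nonneg fun σ => hA.re_inner_nonneg_right _

/-- The reason for finite-dimensional invariant subspaces: the average maps a corner `P A P` to a
corner whenever `P` commutes with the unitaries. -/
theorem conjAverage_conj {P : K →L[ℂ] K} (hP : ∀ σ, Commute (W σ) P) (hPs : IsSelfAdjoint P)
    (A : K →L[ℂ] K) :
    conjAverage W hW hc ν (P * A * P) = P * conjAverage W hW hc ν A * P := by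
  ext1 y
  rw [mul_apply_eq_comp, mul_apply_eq_comp, map_conjAverage, conjAverage_apply]
  refine integral_congr_ae (ae_of_all _ fun σ => ?_)
  have h1 : Commute (star (W σ)) P := by
    have := (hP σ).star_star
    rwa [hPs.star_eq] at this
  have h2 : W σ * (P * A * P) * star (W σ) = P * (W σ * A * star (W σ)) * P := by
    calc _ = (W σ * P) * A * (P * star (W σ)) := by noncomm_ring
      _ = (P * W σ) * A * (star (W σ) * P) := by rw [(hP σ).eq, h1.eq]
      _ = _ := by noncomm_ring
  exact congrArg (fun T : K →L[ℂ] K => T y) h2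

variable {ι : Type*} (b : HilbertBasis ι ℂ K) (F : Finset ι)

theorem integrable_inner_conj (hW : ∀ σ, W σ ∈ unitary (K →L[ℂ] K))
    (hc : ∀ x, Continuous fun σ => W σ x) (A : K →L[ℂ] K) (x y : K) :
    Integrable (fun σ => ⟪x, W σ (A (star (W σ) y))⟫_ℂ) ν :=
  (integrable_conj W hW hc ν A y).const_inner x

theorem basisTrace_conjAverage (hF : ∀ σ, Commute (W σ) (basisProj b F)) (A : K →L[ℂ] K) :
    basisTrace b F (conjAverage W hW hc ν A) = basisTrace b F A := by
  rw [basisTrace_apply]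
  simp only [inner_conjAverage]
  rw [← integral_finsetSum _ fun i _ => integrable_inner_conj ν hW hc A _ _]
  have h : ∀ σ, ∑ i ∈ F, ⟪b i, W σ (A (star (W σ) (b i)))⟫_ℂ = basisTrace b F A := fun σ => by
    rw [← basisTrace_conj b F A (hW σ) (hF σ), basisTrace_apply]
    rfl
  simp [h]

/-- The mean square defect of the commutation of `X` with the unitaries `W(σ)`. -/
theorem integral_defect (hF : ∀ σ, Commute (W σ) (basisProj b F)) {X : K →L[ℂ] K}
    (hX : IsSelfAdjoint X) :
    ∫ σ, ∑ i ∈ F, ‖W σ (X (star (W σ) (b i))) - X (b i)‖ ^ 2 ∂ν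
      = 2 * ∑ i ∈ F, ‖X (b i)‖ ^ 2
        - 2 * RCLike.re (∑ i ∈ F, ⟪X (b i), conjAverage W hW hc ν X (b i)⟫_ℂ) := by
  have h0 : ∀ x : K, RCLike.re ⟪x, (X * X) x⟫_ℂ = ‖X x‖ ^ 2 := fun x => by
    rw [mul_apply_eq_comp, ← inner_selfAdjoint hX, inner_self_eq_norm_sq]
  -- Conjugation preserves the Hilbert–Schmidt norm on the span of `F`: `(W X W*)² = W X² W*`, and
  -- the partial trace of `X²` is invariant.
  have h1 : ∀ σ, ∑ i ∈ F, ‖W σ (X (star (W σ) (b i)))‖ ^ 2 = ∑ i ∈ F, ‖X (b i)‖ ^ 2 := fun σ => by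
    have h2 := congrArg RCLike.re (basisTrace_conj b F (X * X) (hW σ) (hF σ))
    rw [basisTrace_apply, basisTrace_apply, map_sum, map_sum] at h2
    simp only [h0] at h2
    rw [← h2]
    refine Finset.sum_congr rfl fun i _ => ?_
    have h3 : W σ * (X * X) * star (W σ)
        = (W σ * X * star (W σ)) * (W σ * X * star (W σ)) := by
      calc _ = W σ * X * 1 * X * star (W σ) := by noncomm_ring
        _ = W σ * X * (star (W σ) * W σ) * X * star (W σ) := by
          rw [Unitary.star_mul_self_of_mem (hW σ)]
        _ = _ := by noncomm_ring
    have h4 : IsSelfAdjoint (W σ * X * star (W σ)) := hX.conjugate (W σ)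
    rw [h3, mul_apply_eq_comp, ← inner_selfAdjoint h4, inner_self_eq_norm_sq]
    rfl
  have h5 : ∀ σ, ∑ i ∈ F, ‖W σ (X (star (W σ) (b i))) - X (b i)‖ ^ 2
      = 2 * ∑ i ∈ F, ‖X (b i)‖ ^ 2
        - 2 * ∑ i ∈ F, RCLike.re ⟪X (b i), W σ (X (star (W σ) (b i)))⟫_ℂ := fun σ => by
    simp only [norm_sub_sq (𝕜 := ℂ), Finset.sum_add_distrib, Finset.sum_sub_distrib, h1,
      ← Finset.mul_sum]
    simp only [fun i => inner_re_symm (𝕜 := ℂ) (W σ (X (star (W σ) (b i)))) (X (b i))]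
    ring
  simp only [h5, map_sum, inner_conjAverage]
  have h6 : ∀ i, Integrable (fun σ => RCLike.re ⟪X (b i), W σ (X (star (W σ) (b i)))⟫_ℂ) ν :=
    fun i => (integrable_inner_conj ν hW hc X _ _).re
  rw [integral_sub (integrable_const _) ((integrable_finsetSum _ fun i _ => h6 i).const_mul 2),
    integral_const_mul, integral_const_mul, integral_finsetSum _ fun i _ => h6 i]
  simp only [integral_const, probReal_univ, one_smul]
  congr 2
  refine Finset.sum_congr rfl fun i _ => ?_
  exact integral_re (integrable_inner_conj ν hW hc X _ _)

/-- The integrand is nonnegative and, by strong continuity, continuous. As `ν` charges open sets, a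
vanishing integral makes it vanish at every `σ`, not only almost everywhere. -/
theorem conj_eq_of_integral_defect_nonpos (hW : ∀ σ, W σ ∈ unitary (K →L[ℂ] K))
    (hc : ∀ x, Continuous fun σ => W σ x) [ν.IsOpenPosMeasure] {X : K →L[ℂ] K}
    (h : ∫ σ, ∑ i ∈ F, ‖W σ (X (star (W σ) (b i))) - X (b i)‖ ^ 2 ∂ν ≤ 0) (σ : C) {i : ι}
    (hi : i ∈ F) : W σ (X (star (W σ) (b i))) = X (b i) := by
  have hcont : Continuous fun σ => ∑ i ∈ F, ‖W σ (X (star (W σ) (b i))) - X (b i)‖ ^ 2 :=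
    continuous_finsetSum _ fun i _ =>
      (((continuous_conj W hW hc X (b i)).sub continuous_const).norm).pow 2
  have hnn : ∀ σ, 0 ≤ ∑ i ∈ F, ‖W σ (X (star (W σ) (b i))) - X (b i)‖ ^ 2 := fun σ =>
    Finset.sum_nonneg fun i _ => by positivity
  have h0 := le_antisymm h (integral_nonneg hnn)
  rw [integral_eq_zero_iff_of_nonneg hnn
    (hcont.integrable_of_hasCompactSupport (HasCompactSupport.of_compactSpace _))] at h0
  have h1 := congrFun ((Continuous.ae_eq_iff_eq ν hcont continuous_const).1 h0) σ
  have h2 := (Finset.sum_eq_zero_iff_of_nonneg fun i _ => by positivity).1 h1 i hi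
  simpa [sub_eq_zero] using h2

end Average

/-! ### The collision average `Q_N` and its fixed points -/

section CollisionAverage

theorem card_pairs (N : ℕ) : Fintype.card {p : Fin N × Fin N // p.1 < p.2} = N.choose 2 := by
  rw [Fintype.card_subtype]
  have h1 : (Finset.univ.filter fun p : Fin N × Fin N => p.2 < p.1).card
      = (Finset.univ.filter fun p : Fin N × Fin N => p.1 < p.2).card :=
    Finset.card_equiv (Equiv.prodComm _ _) (by simp)
  have h2 : (Finset.univ : Finset (Fin N)).offDiag
      = (Finset.univ.filter fun p : Fin N × Fin N => p.1 < p.2)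
        ∪ (Finset.univ.filter fun p : Fin N × Fin N => p.2 < p.1) := by
    ext p
    simp [lt_or_lt_iff_ne]
  have h3 := congrArg Finset.card h2
  rw [Finset.card_union_of_disjoint (Finset.disjoint_filter.2 fun p _ h => h.asymm), h1,
    Finset.offDiag_card, Finset.card_univ, Fintype.card_fin] at h3
  rw [Nat.choose_two_right, Nat.mul_sub_one, h3]
  omega

namespace CollisionSpec

variable {H : Type*} [NormedAddCommGroup H] [InnerProductSpace ℂ H] [CompleteSpace H]
  {h : Hamiltonian H} {C : Type*} [MetricSpace C] [CompactSpace C] [MeasurableSpace C]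
  [BorelSpace C] (S : CollisionSpec h C) {N : ℕ}

theorem average_apply (A : TensorPower H N →L[ℂ] TensorPower H N) :
    S.average N A = (((N.choose 2 : ℕ) : ℝ)⁻¹ : ℂ) •
      ∑ p : {p : Fin N × Fin N // p.1 < p.2}, S.pairAverage p.1.1 p.1.2 p.2.ne A := by
  simp [average]

theorem choose_two_ne_zero (hN : 2 ≤ N) : ((N.choose 2 : ℕ) : ℝ) ≠ 0 := by
  exact_mod_cast (Nat.choose_pos hN).ne'

theorem norm_average_le (hN : 2 ≤ N) : ‖S.average N‖ ≤ 1 := by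
  have := S.isProbabilityMeasure_ν
  have h0 := choose_two_ne_zero hN
  refine ContinuousLinearMap.opNorm_le_bound _ zero_le_one fun A => ?_
  rw [average_apply, norm_smul, norm_inv, Complex.norm_real, Real.norm_natCast,
    inv_mul_le_iff₀ (by positivity)]
  refine (norm_sum_le _ _).trans ?_
  refine (Finset.sum_le_sum fun p _ =>
    ContinuousLinearMap.le_of_opNorm_le _ (norm_conjAverage_le _ _ _) A).trans ?_
  simp [card_pairs]

theorem isPositive_average {A : TensorPower H N →L[ℂ] TensorPower H N} (hA : A.IsPositive) :
    (S.average N A).IsPositive := by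
  have := S.isProbabilityMeasure_ν
  rw [average_apply, ← Complex.ofReal_inv]
  refine isPositive_smul ?_ (by positivity)
  exact ContinuousLinearMap.isPositive_sum _ fun p _ => isPositive_conjAverage _ _ _ hA

theorem average_conj {P : TensorPower H N →L[ℂ] TensorPower H N}
    (hP : ∀ i j hij σ, Commute (pairOp i j hij (S.U σ)) P) (hPs : IsSelfAdjoint P)
    (A : TensorPower H N →L[ℂ] TensorPower H N) :
    S.average N (P * A * P) = P * S.average N A * P := by
  have := S.isProbabilityMeasure_ν
  rw [average_apply, average_apply, mul_smul_comm, smul_mul_assoc, Finset.mul_sum, Finset.sum_mul]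
  congr 1
  exact Finset.sum_congr rfl fun p _ => conjAverage_conj _ _ _ (hP _ _ _) hPs A

variable {ι : Type*} (b : HilbertBasis ι ℂ (TensorPower H N)) {F : Finset ι}

theorem basisTrace_average (hN : 2 ≤ N)
    (hF : ∀ i j hij σ, Commute (pairOp i j hij (S.U σ)) (basisProj b F))
    (A : TensorPower H N →L[ℂ] TensorPower H N) :
    basisTrace b F (S.average N A) = basisTrace b F A := by
  have := S.isProbabilityMeasure_ν
  have h0 : ((N.choose 2 : ℕ) : ℂ) ≠ 0 := by exact_mod_cast choose_two_ne_zero hN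
  have h1 : ∀ p : {p : Fin N × Fin N // p.1 < p.2},
      basisTrace b F (S.pairAverage p.1.1 p.1.2 p.2.ne A) = basisTrace b F A :=
    fun p => basisTrace_conjAverage _ _ _ b F (hF _ _ _) A
  rw [average_apply, map_smul, map_sum, Finset.sum_congr rfl fun p _ => h1 p]
  simp [card_pairs, h0]

/-- Strict convexity of the Hilbert–Schmidt norm. By `integral_defect` each pair has a nonnegative
defect `D p`. Summed over the pairs, the cross terms combine through `Q_N X = X` to cancel the
norms, so every `D p` is zero. -/
theorem conj_eq_of_average_eq (hN : 2 ≤ N)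
    (hF : ∀ i j hij σ, Commute (pairOp i j hij (S.U σ)) (basisProj b F))
    {X : TensorPower H N →L[ℂ] TensorPower H N} (hX : IsSelfAdjoint X) (hQ : S.average N X = X)
    {i j : Fin N} (hij : i < j) (σ : C) {α : ι} (hα : α ∈ F) :
    pairOp i j hij.ne (S.U σ) (X (star (pairOp i j hij.ne (S.U σ)) (b α))) = X (b α) := by
  have := S.isProbabilityMeasure_ν
  have := S.isOpenPosMeasure_ν
  let D : {p : Fin N × Fin N // p.1 < p.2} → ℝ := fun p => ∫ σ, ∑ α ∈ F,
    ‖pairOp p.1.1 p.1.2 p.2.ne (S.U σ) (X (star (pairOp p.1.1 p.1.2 p.2.ne (S.U σ)) (b α)))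
      - X (b α)‖ ^ 2 ∂S.ν
  have h0 := choose_two_ne_zero hN
  have hD : ∀ p, D p = 2 * ∑ i ∈ F, ‖X (b i)‖ ^ 2
      - 2 * RCLike.re (∑ i ∈ F, ⟪X (b i), S.pairAverage p.1.1 p.1.2 p.2.ne X (b i)⟫_ℂ) :=
    fun p => integral_defect (fun σ => pairOp_mem_unitary _ _ p.2.ne (S.unitary_U σ))
      (S.continuous_pairOp _ _ p.2.ne) S.ν b F (hF _ _ _) hX
  have hnn : ∀ p, 0 ≤ D p := fun p =>
    integral_nonneg fun σ => Finset.sum_nonneg fun i _ => by positivity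
  have hsumQ : ∑ p : {p : Fin N × Fin N // p.1 < p.2}, S.pairAverage p.1.1 p.1.2 p.2.ne X
      = (((N.choose 2 : ℕ) : ℝ) : ℂ) • X := by
    conv_rhs => rw [← hQ, average_apply, smul_smul]
    rw [mul_inv_cancel₀ (by exact_mod_cast h0), one_smul]
  have hre : ∑ p : {p : Fin N × Fin N // p.1 < p.2},
      RCLike.re (∑ i ∈ F, ⟪X (b i), S.pairAverage p.1.1 p.1.2 p.2.ne X (b i)⟫_ℂ)
      = ((N.choose 2 : ℕ) : ℝ) * ∑ i ∈ F, ‖X (b i)‖ ^ 2 := by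
    rw [← map_sum, Finset.sum_comm, map_sum, Finset.mul_sum]
    refine Finset.sum_congr rfl fun i _ => ?_
    rw [← inner_sum, ← sum_apply, hsumQ, smul_apply, inner_smul_right]
    refine (Complex.re_ofReal_mul _ _).trans ?_
    rw [← inner_self_eq_norm_sq (𝕜 := ℂ)]
    rfl
  have hsum : ∑ p, D p = 0 := by
    simp only [hD]
    rw [Finset.sum_sub_distrib, ← Finset.mul_sum, ← Finset.mul_sum, hre]
    simp [card_pairs]
  have hz := (Finset.sum_eq_zero_iff_of_nonneg fun p _ => hnn p).1 hsum ⟨(i, j), hij⟩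
    (Finset.mem_univ _)
  exact conj_eq_of_integral_defect_nonpos S.ν b F
    (fun σ => pairOp_mem_unitary i j hij.ne (S.unitary_U σ)) (S.continuous_pairOp i j hij.ne) hz.le σ hα

end CollisionSpec

end CollisionAverage

universe u

/-! ### Eigenbasis of an operator with compact resolvent -/

section CompactSelfAdjoint

variable {H : Type u} [NormedAddCommGroup H] [InnerProductSpace ℂ H] [CompleteSpace H]

/-- The spectral theorem for compact self-adjoint operators: there is an orthonormal basis of
eigenvectors. -/
theorem exists_hilbertBasis_eigenvectors {R : H →L[ℂ] H} (hR : IsCompactOperator R)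
    (hs : R.IsSymmetric) :
    ∃ (J : Type u) (ψ : HilbertBasis J ℂ H) (μ : J → ℂ), ∀ j, R (ψ j) = μ j • ψ j := by
  -- Every complex `μ` is admitted: a number that is not an eigenvalue contributes an empty basis,
  -- and `μ = 0` contributes the kernel, which need not be finite-dimensional.
  let V : ℂ → Submodule ℂ H := fun μ => Module.End.eigenspace R.toLinearMap μ
  have hV : OrthogonalFamily ℂ (fun μ => V μ) fun μ => (V μ).subtypeₗᵢ :=
    hs.orthogonalFamily_eigenspaces
  have hc : ∀ μ, CompleteSpace (V μ) := fun μ => by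
    have h1 : IsClosed (V μ : Set H) := by
      have h2 : (V μ : Set H) = {x | R x = μ • x} := by
        ext x
        exact Module.End.mem_eigenspace_iff
      rw [h2]
      exact isClosed_eq R.continuous (continuous_const_smul μ)
    exact h1.completeSpace_coe
  have ho := hV.orthonormal_sigma_orthonormal (v_family := fun μ i => onb (V μ) i)
    fun μ => (onb (V μ)).orthonormal
  refine ⟨(μ : ℂ) × OnbIdx (V μ), HilbertBasis.mkOfOrthogonalEqBot ho ?_, fun j => j.1, fun j => ?_⟩
  · rw [eq_bot_iff, ← R.orthogonalComplement_iSup_eigenspaces_eq_bot hR hs]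
    intro x hx
    rw [Submodule.mem_orthogonal'] at hx
    have h1 : ∀ μ, V μ ≤ (ℂ ∙ x)ᗮ := fun μ => by
      have h2 : x ∈ (V μ)ᗮ := mem_orthogonal_of_hilbertBasis (onb (V μ)) fun i => by
        have h3 : ⟪x, (onb (V μ) i : H)⟫_ℂ = 0 := hx _ (Submodule.subset_span ⟨⟨μ, i⟩, rfl⟩)
        rw [← inner_conj_symm, h3, map_zero]
      intro y hy
      rw [Submodule.mem_orthogonal_singleton_iff_inner_right]
      exact Submodule.inner_left_of_mem_orthogonal hy h2
    rw [Submodule.mem_orthogonal']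
    intro y hy
    exact Submodule.mem_orthogonal_singleton_iff_inner_right.1 ((iSup_le h1 : _ ≤ (ℂ ∙ x)ᗮ) hy)
  · rw [HilbertBasis.coe_mkOfOrthogonalEqBot]
    exact Module.End.mem_eigenspace_iff.1 (onb (V j.1) j.2).2

/-- The eigenvalues of a compact operator (counted with multiplicities) only accumulate at `0`. -/
theorem finite_eigenvalues {R : H →L[ℂ] H} (hR : IsCompactOperator R) {J : Type*} {ψ : J → H}
    (hψ : Orthonormal ℂ ψ) {μ : J → ℂ} (hμ : ∀ j, R (ψ j) = μ j • ψ j) {r : ℝ} (hr : 0 < r) :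
    {j | r ≤ ‖μ j‖}.Finite := by
  obtain ⟨K, hK, hRK⟩ := hR.image_closedBall_subset_compact (f := R.toLinearMap) 1
  -- A ball of radius `r/2` contains `R (ψ j)` for at most one `j` with `‖μ j‖ ≥ r`: for `k ≠ j` the
  -- inner product of `ψ j` with `R (ψ j) - R (ψ k)` is `μ j`, so the two images are at distance at
  -- least `r`.
  obtain ⟨t, ht, hKt⟩ := Metric.totallyBounded_iff.1 hK.totallyBounded (r / 2) (by positivity)
  refine (ht.biUnion (t := fun y => {j | r ≤ ‖μ j‖ ∧ R (ψ j) ∈ Metric.ball y (r / 2)})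
    fun y _ => Set.Subsingleton.finite fun j hj k hk => ?_).subset fun j hj => ?_
  · by_contra hjk
    have h1 : ‖R (ψ j) - R (ψ k)‖ < r := by
      rw [← dist_eq_norm]
      have := dist_triangle_right (R (ψ j)) (R (ψ k)) y
      linarith [Metric.mem_ball.1 hj.2, Metric.mem_ball.1 hk.2]
    have h2 : ⟪ψ j, R (ψ j) - R (ψ k)⟫_ℂ = μ j := by
      rw [hμ, hμ, inner_sub_right, inner_smul_right, inner_smul_right, hψ.2 hjk,
        inner_self_eq_norm_sq_to_K, hψ.1]
      simp
    have h3 := norm_inner_le_norm (𝕜 := ℂ) (ψ j) (R (ψ j) - R (ψ k))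
    rw [h2, hψ.1, one_mul] at h3
    linarith [hj.1]
  · have h1 : R (ψ j) ∈ K := hRK ⟨ψ j, by simp [hψ.1], rfl⟩
    obtain ⟨y, hy, h2⟩ := Set.mem_iUnion₂.1 (hKt h1)
    exact Set.mem_iUnion₂.2 ⟨y, hy, hj, h2⟩

end CompactSelfAdjoint

namespace Hamiltonian

variable {H : Type u} [NormedAddCommGroup H] [InnerProductSpace ℂ H] [CompleteSpace H]
  (h : Hamiltonian H)

theorem inner_op (x y : h.op.domain) : ⟪h.op x, (y : H)⟫_ℂ = ⟪(x : H), h.op y⟫_ℂ := by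
  have h1 := LinearPMap.adjoint_isFormalAdjoint h.selfAdjoint.dense_domain
  rw [LinearPMap.isSelfAdjoint_def.1 h.selfAdjoint] at h1
  exact h1 x y

/-- An orthonormal basis of eigenvectors of `h`; the eigenvalues are bounded below and there are
finitely many below each level. -/
theorem exists_eigenbasis : ∃ (J : Type u) (ψ : HilbertBasis J ℂ H) (e : J → ℝ),
    (∀ j, ∃ hj : ψ j ∈ h.op.domain, h.op ⟨ψ j, hj⟩ = (e j : ℂ) • ψ j) ∧
      (∃ c : ℝ, ∀ j, c ≤ e j) ∧ ∀ M : ℝ, {j | e j ≤ M}.Finite := by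
  obtain ⟨z, R, hR, hR1, hR2⟩ := h.compactResolvent
  have hop : ∀ y, h.op ⟨R y, (hR1 y).choose⟩ = (z : ℂ) • R y + y := fun y => by
    rw [← sub_eq_iff_eq_add']
    exact (hR1 y).choose_spec
  -- The resolvent inherits symmetry from `h` because `z` is real.
  have hs : R.IsSymmetric := fun x y => by
    have h1 := h.inner_op ⟨R x, (hR1 x).choose⟩ ⟨R y, (hR1 y).choose⟩
    rw [hop, hop, inner_add_left, inner_add_right, inner_smul_left, inner_smul_right,
      Complex.conj_ofReal] at h1
    exact (add_left_cancel h1).symm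
  obtain ⟨J, ψ, μ, hμ⟩ := exists_hilbertBasis_eigenvectors hR hs
  have hne : ∀ j, ψ j ≠ 0 := fun j => ψ.orthonormal.ne_zero j
  have hμ0 : ∀ j, μ j ≠ 0 := fun j h0 => by
    have h1 : R (ψ j) = 0 := by rw [hμ, h0, zero_smul]
    have h2 := hop (ψ j)
    have h3 : (⟨R (ψ j), (hR1 (ψ j)).choose⟩ : h.op.domain) = 0 := Subtype.ext h1
    rw [h3, LinearPMap.map_zero, h1, smul_zero, zero_add] at h2
    exact hne j h2.symm
  have hreal : ∀ j, starRingEnd ℂ (μ j) = μ j := fun j => by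
    have h1 := hs (ψ j) (ψ j)
    simp only [ContinuousLinearMap.coe_coe] at h1
    rw [hμ, inner_smul_left, inner_smul_right] at h1
    exact mul_right_cancel₀ (inner_self_ne_zero.2 (hne j)) h1
  have hinv : ∀ j, (((μ j)⁻¹.re : ℝ) : ℂ) = (μ j)⁻¹ := fun j => by
    rw [← Complex.conj_eq_iff_re, map_inv₀, hreal]
  have hdom : ∀ j, ψ j = (μ j)⁻¹ • R (ψ j) := fun j => by
    rw [hμ, smul_smul, inv_mul_cancel₀ (hμ0 j), one_smul]
  -- `R ψ = μ ψ` with `μ ≠ 0` means `(h - z) ψ = μ⁻¹ ψ`.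
  have heig : ∀ j, ∃ hj : ψ j ∈ h.op.domain,
      h.op ⟨ψ j, hj⟩ = ((z + (μ j)⁻¹.re : ℝ) : ℂ) • ψ j := fun j => by
    have hj : ψ j ∈ h.op.domain := by
      rw [hdom]
      exact Submodule.smul_mem _ _ (hR1 _).choose
    refine ⟨hj, ?_⟩
    have h1 : (⟨ψ j, hj⟩ : h.op.domain) = (μ j)⁻¹ • ⟨R (ψ j), (hR1 (ψ j)).choose⟩ :=
      Subtype.ext (hdom j)
    rw [h1, LinearPMap.map_smul, hop, smul_add, smul_comm, ← hdom, Complex.ofReal_add, hinv, add_smul]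
  obtain ⟨c, hc⟩ := h.boundedBelow
  have hle : ∀ j, c ≤ z + (μ j)⁻¹.re := fun j => by
    obtain ⟨hj, h1⟩ := heig j
    have h2 := hc ⟨ψ j, hj⟩
    rw [h1, inner_smul_right, inner_self_eq_norm_sq_to_K] at h2
    simp only [ψ.orthonormal.1 j] at h2
    simpa using h2
  refine ⟨J, ψ, fun j => z + (μ j)⁻¹.re, heig, ⟨c, hle⟩, fun M => ?_⟩
  -- Eigenvalues of `h` between `c` and `M` have `|μ⁻¹| ≤ |c - z| + |M - z| + 1`, so `|μ|` stays
  -- away from zero. The summand `1` keeps the bound positive.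
  refine (finite_eigenvalues hR ψ.orthonormal hμ
    (r := (|c - z| + |M - z| + 1)⁻¹) (by positivity)).subset fun j hj => ?_
  have h1 : ‖(μ j)⁻¹‖ ≤ |c - z| + |M - z| + 1 := by
    rw [← hinv, Complex.norm_real, Real.norm_eq_abs, abs_le]
    have h2 := hle j
    have h3 : z + (μ j)⁻¹.re ≤ M := hj
    constructor
    · linarith [neg_abs_le (c - z), abs_nonneg (M - z)]
    · linarith [le_abs_self (M - z), abs_nonneg (c - z)]
  rw [norm_inv] at h1
  exact inv_le_of_inv_le₀ (norm_pos_iff.2 (hμ0 j)) h1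

end Hamiltonian

/-! ### Product bases of the tensor power -/

section TensorBasis

variable {H : Type*} [NormedAddCommGroup H] [InnerProductSpace ℂ H] [CompleteSpace H] {N : ℕ}

theorem productVector_apply_eq_multilinear (φ : Fin N → H) (α : Fin N → OnbIdx H) :
    productVector φ α = (MultilinearMap.mkPiAlgebra ℂ (Fin N) ℂ).compLinearMap
      (fun k => (lp.evalₗ (𝕜 := ℂ) (fun _ : OnbIdx H => ℂ) 2 (α k)).comp
        ((onb H).repr.toLinearEquiv : H →ₗ[ℂ] L2 (OnbIdx H))) φ := by
  simp [productVector_apply]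

theorem productVector_update_add (φ : Fin N → H) (k : Fin N) (x y : H) :
    productVector (Function.update φ k (x + y))
      = productVector (Function.update φ k x) + productVector (Function.update φ k y) := by
  ext α
  rw [lp.coeFn_add, Pi.add_apply]
  simp only [productVector_apply_eq_multilinear, MultilinearMap.map_update_add]

theorem productVector_update_smul (φ : Fin N → H) (k : Fin N) (c : ℂ) (x : H) :
    productVector (Function.update φ k (c • x)) = c • productVector (Function.update φ k x) := by
  ext α
  rw [lp.coeFn_smul, Pi.smul_apply]
  simp only [productVector_apply_eq_multilinear, MultilinearMap.map_update_smul]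

theorem productVector_smul (c : Fin N → ℂ) (φ : Fin N → H) :
    productVector (fun k => c k • φ k) = (∏ k, c k) • productVector φ := by
  ext α
  simp [productVector_apply, Finset.prod_mul_distrib]

theorem norm_productVector (φ : Fin N → H) : ‖productVector φ‖ = ∏ k, ‖φ k‖ := by
  have h1 : ((‖productVector φ‖ ^ 2 : ℝ) : ℂ) = (((∏ k, ‖φ k‖) ^ 2 : ℝ) : ℂ) := by
    have := inner_productVector φ φ
    simp only [inner_self_eq_norm_sq_to_K] at this
    rw [Finset.prod_pow] at this
    exact_mod_cast this
  exact (pow_left_inj₀ (norm_nonneg _) (Finset.prod_nonneg fun k _ => norm_nonneg _) two_ne_zero).1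
    (Complex.ofReal_injective h1)

/-- The product vector as a continuous linear function of one of its factors. -/
def productVectorUpdate (φ : Fin N → H) (k : Fin N) : H →L[ℂ] TensorPower H N :=
  LinearMap.mkContinuous
    { toFun := fun x => productVector (Function.update φ k x)
      map_add' := productVector_update_add φ k
      map_smul' := productVector_update_smul φ k } (∏ l ∈ Finset.univ.erase k, ‖φ l‖) fun x => by
    refine le_of_eq ?_
    change ‖productVector (Function.update φ k x)‖ = _
    rw [norm_productVector, ← Finset.mul_prod_erase _ _ (Finset.mem_univ k), Function.update_self,
      mul_comm]
    congr 1
    refine Finset.prod_congr rfl fun l hl => ?_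
    rw [Function.update_of_ne (Finset.ne_of_mem_erase hl)]

variable {J : Type*} (ψ : HilbertBasis J ℂ H)

theorem orthonormal_productVector :
    Orthonormal ℂ fun α : Fin N → J => productVector fun k => ψ (α k) := by
  refine ⟨fun α => ?_, fun α β hαβ => ?_⟩
  · simp [norm_productVector, ψ.orthonormal.1]
  · obtain ⟨k, hk⟩ := Function.ne_iff.1 hαβ
    dsimp only
    rw [inner_productVector]
    exact Finset.prod_eq_zero (Finset.mem_univ k) (ψ.orthonormal.2 hk)

/-- Induction on the set `s` of slots in which arbitrary vectors are allowed. Freeing one more slot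
uses that a continuous linear functional vanishing on a Hilbert basis is zero. -/
theorem inner_productVector_eq_zero {x : TensorPower H N}
    (hx : ∀ α : Fin N → J, ⟪x, productVector fun k => ψ (α k)⟫_ℂ = 0) (s : Finset (Fin N)) :
    ∀ φ : Fin N → H, (∀ k ∉ s, φ k ∈ Set.range ψ) → ⟪x, productVector φ⟫_ℂ = 0 := by
  induction s using Finset.induction_on with
  | empty =>
    intro φ hφ
    choose α hα using fun k => hφ k (Finset.notMem_empty k)
    have := hx α
    simpa only [hα] using this
  | insert a s ha ih =>
    intro φ hφ
    have h1 : (innerSL ℂ x).comp (productVectorUpdate φ a) = 0 := by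
      refine ext_hilbertBasis ψ fun j => ?_
      change ⟪x, productVector (Function.update φ a (ψ j))⟫_ℂ = 0
      refine ih _ fun k hk => ?_
      by_cases hka : k = a
      · subst hka
        exact ⟨j, by simp⟩
      · rw [Function.update_of_ne hka]
        exact hφ k (by simp [hka, hk])
    have h2 := congrArg (fun T : H →L[ℂ] ℂ => T (φ a)) h1
    change ⟪x, productVector (Function.update φ a (φ a))⟫_ℂ = 0 at h2
    rwa [Function.update_eq_self] at h2

/-- The product basis of the tensor power associated with a Hilbert basis. -/
def tensorBasis (N : ℕ) : HilbertBasis (Fin N → J) ℂ (TensorPower H N) :=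
  HilbertBasis.mkOfOrthogonalEqBot (orthonormal_productVector ψ) (by
    rw [eq_bot_iff]
    intro x hx
    rw [Submodule.mem_orthogonal'] at hx
    have h1 : ∀ φ : Fin N → H, ⟪x, productVector φ⟫_ℂ = 0 := fun φ =>
      inner_productVector_eq_zero ψ (fun α => hx _ (Submodule.subset_span ⟨α, rfl⟩)) Finset.univ φ
        (by simp)
    have h2 : innerSL ℂ x = 0 := by
      refine ContinuousLinearMap.ext_on (dense_span_productVector N) ?_
      rintro _ ⟨φ, rfl⟩
      exact h1 φ
    have h3 := congrArg (fun T : TensorPower H N →L[ℂ] ℂ => T x) h2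
    exact inner_self_eq_zero.1 h3)

theorem tensorBasis_apply (α : Fin N → J) :
    tensorBasis ψ N α = productVector fun k => ψ (α k) := by
  rw [tensorBasis, HilbertBasis.coe_mkOfOrthogonalEqBot]

end TensorBasis

/-! ### Commutation with `A ⊗ 1` in terms of matrix blocks -/

section Blocks

variable {X Y Z : Type*}

theorem norm_slice_le (e : Z ≃ X × Y) (y : Y) (f : L2 Z) : ‖slice e y f‖ ≤ 1 * ‖f‖ := by
  rw [one_mul]
  refine le_of_sq_le_sq ?_ (norm_nonneg _)
  rw [← tsum_slice e f]
  exact (summable_slice e f).le_tsum y fun _ _ => by positivity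

/-- The section of a square-summable family, as a bounded operator. -/
def sliceL (e : Z ≃ X × Y) (y : Y) : L2 Z →L[ℂ] L2 X :=
  (slice e y).mkContinuous 1 (norm_slice_le e y)

theorem sliceL_comp_tensorOne (e : Z ≃ X × Y) (y : Y) (A : L2 X →L[ℂ] L2 X) :
    sliceL e y ∘L tensorOne e A = A ∘L sliceL e y := by
  ext1 f
  exact slice_tensorOne e A f y

theorem tensorOne_comp_adjoint_sliceL (e : Z ≃ X × Y) (y : Y) (A : L2 X →L[ℂ] L2 X) :
    tensorOne e A ∘L (sliceL e y).adjoint = (sliceL e y).adjoint ∘L A := by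
  have h := congrArg ContinuousLinearMap.adjoint (sliceL_comp_tensorOne e y (star A))
  rw [ContinuousLinearMap.adjoint_comp, ContinuousLinearMap.adjoint_comp,
    ← ContinuousLinearMap.star_eq_adjoint (tensorOne e (star A)),
    ← ContinuousLinearMap.star_eq_adjoint (star A), star_tensorOne, star_star] at h
  exact h

/-- The adjoints of the slices embed `ℓ²(X)` as the mutually orthogonal summands of `ℓ²(Z)` indexed
by `Y`. On the adjoint side the claim says that a vector is determined by its sections. -/
theorem ext_comp_adjoint_sliceL (e : Z ≃ X × Y) {E : Type*} [NormedAddCommGroup E]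
    [InnerProductSpace ℂ E] [CompleteSpace E] {A B : L2 Z →L[ℂ] E}
    (h : ∀ y, A ∘L (sliceL e y).adjoint = B ∘L (sliceL e y).adjoint) : A = B := by
  refine ContinuousLinearMap.adjoint.injective ?_
  ext1 x
  refine ext_slice e fun y => ?_
  have h1 := congrArg ContinuousLinearMap.adjoint (h y)
  rw [ContinuousLinearMap.adjoint_comp, ContinuousLinearMap.adjoint_comp,
    ContinuousLinearMap.adjoint_adjoint] at h1
  exact congrArg (fun T : E →L[ℂ] L2 X => T x) h1

/-- The matrix blocks of an operator on `ℓ²(X) ⊗ ℓ²(Y)`, which are operators on `ℓ²(X)`. -/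
def block (e : Z ≃ X × Y) (T : L2 Z →L[ℂ] L2 Z) (y y' : Y) : L2 X →L[ℂ] L2 X :=
  sliceL e y ∘L T ∘L (sliceL e y').adjoint

/-- Slices and their adjoints intertwine `A ⊗ 1` with `A`. Together with the converse below, this
transfers commutation relations on `H^{⊗N}` to `H ⊗ H`, where ergodicity applies, and back. -/
theorem commute_block (e : Z ≃ X × Y) {T : L2 Z →L[ℂ] L2 Z} {A : L2 X →L[ℂ] L2 X}
    (h : Commute T (tensorOne e A)) (y y' : Y) : Commute (block e T y y') A := by
  have h' : T ∘L tensorOne e A = tensorOne e A ∘L T := h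
  change (sliceL e y ∘L T ∘L (sliceL e y').adjoint) ∘L A
    = A ∘L (sliceL e y ∘L T ∘L (sliceL e y').adjoint)
  rw [ContinuousLinearMap.comp_assoc, ContinuousLinearMap.comp_assoc,
    ← tensorOne_comp_adjoint_sliceL, ← ContinuousLinearMap.comp_assoc T, h',
    ContinuousLinearMap.comp_assoc, ← ContinuousLinearMap.comp_assoc (sliceL e y),
    sliceL_comp_tensorOne, ContinuousLinearMap.comp_assoc]

theorem commute_tensorOne_of_block (e : Z ≃ X × Y) {T : L2 Z →L[ℂ] L2 Z} {A : L2 X →L[ℂ] L2 X}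
    (h : ∀ y y', Commute (block e T y y') A) : Commute T (tensorOne e A) := by
  change T ∘L tensorOne e A = tensorOne e A ∘L T
  refine ext_comp_adjoint_sliceL e fun y' => ?_
  ext1 x
  refine ext_slice e fun y => ?_
  have h1 : (sliceL e y ∘L T ∘L (sliceL e y').adjoint) ∘L A
    = A ∘L (sliceL e y ∘L T ∘L (sliceL e y').adjoint) := h y y'
  have h2 : sliceL e y ∘L ((T ∘L tensorOne e A) ∘L (sliceL e y').adjoint)
      = sliceL e y ∘L ((tensorOne e A ∘L T) ∘L (sliceL e y').adjoint) := by
    rw [ContinuousLinearMap.comp_assoc, tensorOne_comp_adjoint_sliceL,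
      ContinuousLinearMap.comp_assoc (tensorOne e A), ← ContinuousLinearMap.comp_assoc (sliceL e y)
      (tensorOne e A), sliceL_comp_tensorOne, ContinuousLinearMap.comp_assoc A, ← h1,
      ContinuousLinearMap.comp_assoc, ContinuousLinearMap.comp_assoc]
  exact congrArg (fun G : L2 X →L[ℂ] L2 X => G x) h2

end Blocks

section PairOp

variable {H : Type*} [NormedAddCommGroup H] [InnerProductSpace ℂ H] [CompleteSpace H] {N : ℕ}

theorem pairOp_productVector_of_eigen {i j : Fin N} (hij : i ≠ j)
    {A : TensorPower H 2 →L[ℂ] TensorPower H 2} {φ : Fin N → H} {c : ℂ}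
    (hA : A (productVector ![φ i, φ j]) = c • productVector ![φ i, φ j]) :
    pairOp i j hij A (productVector φ) = c • productVector φ := by
  refine ext_slice (pairSplit _ i j hij) fun y => ?_
  rw [pairOp, slice_tensorOne, map_smul, slice_productVector, map_smul, hA, smul_comm]

end PairOp

/-! ### Energy shells and the energy algebra -/

namespace Hamiltonian

variable {H : Type*} [NormedAddCommGroup H] [InnerProductSpace ℂ H] [CompleteSpace H]
  (h : Hamiltonian H) {N : ℕ}

/-- The vectors `q` that satisfy the symmetry relation `⟨p₁, q₂⟩ = ⟨p₂, q₁⟩` with a given `p`. -/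
def symmetricRelation {K : Type*} [NormedAddCommGroup K] [InnerProductSpace ℂ K] (p : K × K) :
    Submodule ℂ (K × K) where
  carrier := {q | ⟪p.1, q.2⟫_ℂ = ⟪p.2, q.1⟫_ℂ}
  add_mem' {a b} ha hb := by
    simp only [Set.mem_ofPred_eq, Prod.fst_add, Prod.snd_add, inner_add_right] at *
    rw [ha, hb]
  zero_mem' := by simp
  smul_mem' c a ha := by
    simp only [Set.mem_ofPred_eq, Prod.smul_fst, Prod.smul_snd, inner_smul_right] at *
    rw [ha]

theorem mem_symmetricRelation {K : Type*} [NormedAddCommGroup K] [InnerProductSpace ℂ K]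
    {p q : K × K} : q ∈ symmetricRelation p ↔ ⟪p.1, q.2⟫_ℂ = ⟪p.2, q.1⟫_ℂ := Iff.rfl

theorem mem_symmetricRelation_symm {K : Type*} [NormedAddCommGroup K] [InnerProductSpace ℂ K]
    {p q : K × K} (hq : q ∈ symmetricRelation p) : p ∈ symmetricRelation q := by
  rw [mem_symmetricRelation] at *
  rw [← inner_conj_symm, ← hq, inner_conj_symm]

theorem isClosed_symmetricRelation {K : Type*} [NormedAddCommGroup K] [InnerProductSpace ℂ K]
    (p : K × K) : IsClosed (symmetricRelation p : Set (K × K)) :=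
  isClosed_eq (continuous_const.inner continuous_snd) (continuous_const.inner continuous_fst)

theorem inner_productVector_update (φ χ : Fin N → H) (j : Fin N) (y : H) :
    ⟪productVector φ, productVector (Function.update χ j y)⟫_ℂ
      = ⟪φ j, y⟫_ℂ * ∏ k ∈ Finset.univ.erase j, ⟪φ k, χ k⟫_ℂ := by
  rw [inner_productVector, ← Finset.mul_prod_erase _ _ (Finset.mem_univ j), Function.update_self]
  congr 1
  refine Finset.prod_congr rfl fun l hl => ?_
  rw [Function.update_of_ne (Finset.ne_of_mem_erase hl)]

theorem inner_update_productVector (φ χ : Fin N → H) (j : Fin N) (y : H) :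
    ⟪productVector (Function.update φ j y), productVector χ⟫_ℂ
      = ⟪y, χ j⟫_ℂ * ∏ k ∈ Finset.univ.erase j, ⟪φ k, χ k⟫_ℂ := by
  rw [inner_productVector, ← Finset.mul_prod_erase _ _ (Finset.mem_univ j), Function.update_self]
  congr 1
  refine Finset.prod_congr rfl fun l hl => ?_
  rw [Function.update_of_ne (Finset.ne_of_mem_erase hl)]

/-- The `N`-particle Hamiltonian is symmetric. -/
theorem graph_symmetric {p q : TensorPower H N × TensorPower H N} (hp : p ∈ h.graph N)
    (hq : q ∈ h.graph N) : ⟪p.1, q.2⟫_ℂ = ⟪p.2, q.1⟫_ℂ := by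
  -- For fixed `p` the relation defines a closed subspace, so it suffices to test generators of the
  -- graph. The relation is symmetric in its two arguments, so this reduction is applied to each of
  -- them.
  have key : ∀ p : TensorPower H N × TensorPower H N, (∀ φ : Fin N → h.op.domain,
      (productVector (fun k => (φ k : H)),
        ∑ j, productVector (Function.update (fun k => (φ k : H)) j (h.op (φ j))))
          ∈ symmetricRelation p) → h.graph N ≤ symmetricRelation p := fun p hp =>
    Submodule.topologicalClosure_minimal _ (Submodule.span_le.2 (by
      rintro _ ⟨φ, rfl⟩
      exact hp φ)) (isClosed_symmetricRelation p)
  refine key p (fun φ => mem_symmetricRelation_symm (key _ (fun χ => ?_) hp)) hq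
  rw [mem_symmetricRelation]
  simp only [inner_sum, sum_inner, inner_productVector_update, inner_update_productVector, inner_op]

theorem inner_eq_zero_of_mem_shell {E E' : ℝ} (hE : E ≠ E') {x y : TensorPower H N}
    (hx : x ∈ h.shell N E) (hy : y ∈ h.shell N E') : ⟪x, y⟫_ℂ = 0 := by
  have h1 := h.graph_symmetric (p := (x, (E : ℂ) • x)) (q := (y, (E' : ℂ) • y)) hx hy
  simp only [inner_smul_left, inner_smul_right, Complex.conj_ofReal] at h1
  by_contra h0
  exact hE (Complex.ofReal_injective (mul_right_cancel₀ h0 h1)).symm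

theorem productVector_mem_shell {φ : Fin N → H} {e : Fin N → ℝ}
    (hφ : ∀ k, ∃ hk : φ k ∈ h.op.domain, h.op ⟨φ k, hk⟩ = (e k : ℂ) • φ k) :
    productVector φ ∈ h.shell N (∑ k, e k) := by
  choose hd he using hφ
  have h1 := Submodule.le_topologicalClosure _ (Submodule.subset_span
    (s := Set.range fun φ : Fin N → h.op.domain => (productVector (fun k => (φ k : H)),
      ∑ j, productVector (Function.update (fun k => (φ k : H)) j (h.op (φ j)))))
    (R := ℂ) ⟨fun k => ⟨φ k, hd k⟩, rfl⟩)
  simp only [he, productVector_update_smul, Function.update_eq_self, ← Finset.sum_smul] at h1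
  change (productVector φ, ((∑ k, e k : ℝ) : ℂ) • productVector φ) ∈ h.graph N
  rw [Complex.ofReal_sum]
  exact h1

/-- An operator in the energy algebra acts as a scalar on each vector in an energy shell, as does
its adjoint. -/
theorem exists_smul_of_mem_energyAlgebra {A : TensorPower H N →L[ℂ] TensorPower H N}
    (hA : A ∈ h.energyAlgebra N) {E : ℝ} {v : TensorPower H N} (hv : v ∈ h.shell N E) :
    ∃ c : ℂ, A v = c • v ∧ ∀ x, ⟪v, A x⟫_ℂ = c * ⟪v, x⟫_ℂ := by
  obtain ⟨f, -, hf⟩ := hA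
  have h0 : ∀ E', E' ≠ E → (h.shell N E').starProjection v = 0 := fun E' hE' => by
    rw [Submodule.starProjection_apply_eq_zero_iff, Submodule.mem_orthogonal]
    exact fun u hu => h.inner_eq_zero_of_mem_shell hE' hu hv
  have h1 : (h.shell N E).starProjection v = v := Submodule.starProjection_eq_self_iff.2 hv
  refine ⟨f E, ?_, fun x => ?_⟩
  · have h2 := hasSum_single (f := fun E' : ℝ => f E' • (h.shell N E').starProjection v) E
      fun E' hE' => by rw [h0 E' hE', smul_zero]
    rw [h1] at h2
    exact (hf v).unique h2
  · have h2 := (innerSL ℂ v).hasSum (hf x)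
    have h3 : ∀ E', innerSL ℂ v (f E' • (h.shell N E').starProjection x)
        = f E' * ⟪(h.shell N E').starProjection v, x⟫_ℂ := fun E' => by
      rw [innerSL_apply_apply, inner_smul_right, Submodule.inner_starProjection_left_eq_right]
    simp only [h3] at h2
    have h4 := hasSum_single (f := fun E' : ℝ => f E' * ⟪(h.shell N E').starProjection v, x⟫_ℂ) E
      fun E' hE' => by rw [h0 E' hE', inner_zero_left, mul_zero]
    rw [h1] at h4
    exact h2.unique h4

/-- Acting as a scalar on `v` is not enough for this; the adjoint must act on `v` by the conjugate
scalar, which is the second half of `exists_smul_of_mem_energyAlgebra`. -/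
theorem commute_rankOne_of_mem_energyAlgebra {A : TensorPower H N →L[ℂ] TensorPower H N}
    (hA : A ∈ h.energyAlgebra N) {E : ℝ} {v : TensorPower H N} (hv : v ∈ h.shell N E) :
    Commute A (InnerProductSpace.rankOne ℂ v v) := by
  obtain ⟨c, h1, h2⟩ := h.exists_smul_of_mem_energyAlgebra hA hv
  ext1 x
  rw [mul_apply_eq_comp, mul_apply_eq_comp, InnerProductSpace.rankOne_apply,
    InnerProductSpace.rankOne_apply, map_smul, h1, h2, smul_smul, mul_comm]

end Hamiltonian

/-! ### Energy conservation and the diagonal form of equilibria -/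

namespace CollisionSpec

variable {H : Type*} [NormedAddCommGroup H] [InnerProductSpace ℂ H] [CompleteSpace H]
  {h : Hamiltonian H} {C : Type*} [MetricSpace C] [CompactSpace C] [MeasurableSpace C]
  [BorelSpace C] (S : CollisionSpec h C) {N : ℕ}

theorem U_mem_shell {E : ℝ} {x : TensorPower H 2} (hx : x ∈ h.shell 2 E) (σ : C) :
    S.U σ x ∈ h.shell 2 E := by
  have h1 := (S.commute_H2 σ x ((E : ℂ) • x)).2 hx
  rw [map_smul] at h1
  exact h1

variable {J : Type*} {ψ : HilbertBasis J ℂ H} {e : J → ℝ}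

theorem pair_mem_shell
    (hψ : ∀ j, ∃ hj : ψ j ∈ h.op.domain, h.op ⟨ψ j, hj⟩ = (e j : ℂ) • ψ j) (a b : J) : productVector ![ψ a, ψ b] ∈ h.shell 2 (e a + e b) := by
  have h1 := h.productVector_mem_shell (φ := ![ψ a, ψ b]) (e := ![e a, e b]) (fun k => by
    fin_cases k
    · exact hψ a
    · exact hψ b)
  simpa [Fin.sum_univ_two] using h1

/-- Collisions conserve the energy. -/
theorem inner_pairOp_eq_zero
    (hψ : ∀ j, ∃ hj : ψ j ∈ h.op.domain, h.op ⟨ψ j, hj⟩ = (e j : ℂ) • ψ j)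
    {i j : Fin N} (hij : i ≠ j) (σ : C) {α β : Fin N → J} (hE : ∑ k, e (α k) ≠ ∑ k, e (β k)) :
    ⟪tensorBasis ψ N α, pairOp i j hij (S.U σ) (tensorBasis ψ N β)⟫_ℂ = 0 := by
  rw [tensorBasis_apply, tensorBasis_apply, inner_productVector_pairOp]
  -- The matrix element factorises. If `α` and `β` differ outside the pair, an overlap vanishes.
  -- Otherwise the pair energies differ, and `U σ` preserves the energy shells of `H_2`, which are
  -- mutually orthogonal.
  by_cases hk : ∃ k, (k ≠ i ∧ k ≠ j) ∧ α k ≠ β k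
  · obtain ⟨k, hk, hne⟩ := hk
    rw [Finset.prod_eq_zero (Finset.mem_univ ⟨k, hk⟩) (ψ.orthonormal.2 hne), mul_zero]
  · push Not at hk
    have h1 : e (α i) + e (α j) ≠ e (β i) + e (β j) := fun h0 => hE <| by
      rw [← sub_eq_zero, ← Finset.sum_sub_distrib, ← Finset.sum_subset (Finset.subset_univ {i, j}),
        Finset.sum_pair hij]
      · linarith
      · intro k _ hk'
        simp only [Finset.mem_insert, Finset.mem_singleton, not_or] at hk'
        rw [hk k hk', sub_self]
    rw [h.inner_eq_zero_of_mem_shell h1 (pair_mem_shell hψ _ _)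
      (S.U_mem_shell (pair_mem_shell hψ _ _) σ), zero_mul]

/-- Since the other `N - 1` energies are at least `c`, a total of at most `M` bounds each single one
by `M - N c + c`, which leaves finitely many choices in every slot. -/
theorem finite_energy_le {c : ℝ} (hc : ∀ j, c ≤ e j) (he : ∀ M : ℝ, {j | e j ≤ M}.Finite) (N : ℕ)
    (M : ℝ) : {α : Fin N → J | ∑ k, e (α k) ≤ M}.Finite := by
  refine (Set.Finite.pi' fun _ : Fin N => he (M - N * c + c)).subset fun α hα k => ?_
  have h1 : e (α k) - c ≤ ∑ l, (e (α l) - c) :=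
    Finset.single_le_sum (f := fun l => e (α l) - c) (fun l _ => sub_nonneg.2 (hc _))
      (Finset.mem_univ k)
  rw [Finset.sum_sub_distrib] at h1
  have h2 : ∑ k, e (α k) ≤ M := hα
  have h3 : ∑ _l : Fin N, c = N * c := by simp
  change e (α k) ≤ _
  linarith

theorem commute_pairOp_basisProj
    (hψ : ∀ j, ∃ hj : ψ j ∈ h.op.domain, h.op ⟨ψ j, hj⟩ = (e j : ℂ) • ψ j)
    {F : Finset (Fin N → J)} {M : ℝ} (hF : ∀ α, α ∈ F ↔ ∑ k, e (α k) ≤ M)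
    (i j : Fin N) (hij : i ≠ j) (σ : C) :
    Commute (pairOp i j hij (S.U σ)) (basisProj (tensorBasis ψ N) F) := by
  refine commute_basisProj _ _ fun α β hαβ => S.inner_pairOp_eq_zero hψ hij σ fun hE => ?_
  rw [hF, hF, hE] at hαβ
  tauto

/-- In the ergodic case, operators which commute with the collision operators of a pair do not
couple product eigenvectors which differ at this pair. -/
theorem inner_eq_zero_of_commute_pairOp (hS : S.IsErgodic)
    (hψ : ∀ j, ∃ hj : ψ j ∈ h.op.domain, h.op ⟨ψ j, hj⟩ = (e j : ℂ) • ψ j)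
    {i j : Fin N} (hij : i ≠ j) {X : TensorPower H N →L[ℂ] TensorPower H N}
    (hX : ∀ σ, Commute X (pairOp i j hij (S.U σ))) {α β : Fin N → J}
    (hαβ : α i ≠ β i ∨ α j ≠ β j) : ⟪tensorBasis ψ N β, X (tensorBasis ψ N α)⟫_ℂ = 0 := by
  let v : TensorPower H 2 := productVector ![ψ (α i), ψ (α j)]
  let B : TensorPower H 2 →L[ℂ] TensorPower H 2 := InnerProductSpace.rankOne ℂ v v
  -- The blocks of `X` commute with all `U σ`, so by ergodicity they lie in the energy algebra and
  -- commute with the projection `B` onto the eigenvector `v` of `H_2`.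
  have hB : Commute X (pairOp i j hij B) := by
    refine commute_tensorOne_of_block _ fun y y' => ?_
    have h1 : block (pairSplit _ i j hij) X y y' ∈ Set.centralizer (Set.range S.U) := by
      rw [Set.mem_centralizer_iff]
      rintro _ ⟨σ, rfl⟩
      exact (commute_block _ (hX σ) y y').eq.symm
    rw [show Set.centralizer (Set.range S.U) = h.energyAlgebra 2 from hS] at h1
    exact h.commute_rankOne_of_mem_energyAlgebra h1 (pair_mem_shell hψ _ _)
  have hBs : IsSelfAdjoint (pairOp (N := N) i j hij B) := by
    rw [IsSelfAdjoint, pairOp, star_tensorOne]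
    congr 1
    exact (InnerProductSpace.isPositive_rankOne_self v).isSelfAdjoint
  have hv : ⟪v, v⟫_ℂ = 1 := by
    rw [inner_productVector]
    simp [Fin.prod_univ_two, ψ.orthonormal.1]
  have hα : pairOp i j hij B (tensorBasis ψ N α) = tensorBasis ψ N α := by
    rw [tensorBasis_apply, pairOp_productVector_of_eigen (c := 1), one_smul]
    change ⟪v, v⟫_ℂ • v = _
    rw [hv]
  have hβ : pairOp i j hij B (tensorBasis ψ N β) = 0 := by
    rw [tensorBasis_apply, pairOp_productVector_of_eigen (c := 0), zero_smul]
    change ⟪v, productVector ![ψ (β i), ψ (β j)]⟫_ℂ • v = _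
    have h0 : ⟪v, productVector ![ψ (β i), ψ (β j)]⟫_ℂ = 0 := by
      rw [inner_productVector, Fin.prod_univ_two]
      rcases hαβ with h0 | h0
      · exact mul_eq_zero_of_left (ψ.orthonormal.2 h0) _
      · exact mul_eq_zero_of_right _ (ψ.orthonormal.2 h0)
    rw [h0, zero_smul, zero_smul]
  -- The operator `B_{i,j}` fixes the basis vector of `α`, annihilates that of `β`, and commutes
  -- with `X`.
  calc ⟪tensorBasis ψ N β, X (tensorBasis ψ N α)⟫_ℂ
      = ⟪tensorBasis ψ N β, (X * pairOp i j hij B) (tensorBasis ψ N α)⟫_ℂ := by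
        rw [mul_apply_eq_comp, hα]
    _ = ⟪pairOp i j hij B (tensorBasis ψ N β), X (tensorBasis ψ N α)⟫_ℂ := by
        rw [hB.eq, mul_apply_eq_comp, inner_selfAdjoint hBs]
    _ = 0 := by rw [hβ, inner_zero_left]

theorem commute_of_average_eq (hN : 2 ≤ N)
    (hψ : ∀ j, ∃ hj : ψ j ∈ h.op.domain, h.op ⟨ψ j, hj⟩ = (e j : ℂ) • ψ j)
    (hfin : ∀ M : ℝ, {α : Fin N → J | ∑ k, e (α k) ≤ M}.Finite)
    {X : TensorPower H N →L[ℂ] TensorPower H N} (hX : IsSelfAdjoint X) (hQ : S.average N X = X)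
    {i j : Fin N} (hij : i < j) (σ : C) : Commute X (pairOp i j hij.ne (S.U σ)) := by
  set W := pairOp i j hij.ne (S.U σ) with hW
  -- Each basis vector lies in the energy-truncated span whose level is its own energy.
  have h1 : W * X * star W = X := ext_hilbertBasis (tensorBasis ψ N) fun α =>
    S.conj_eq_of_average_eq (tensorBasis ψ N) (F := (hfin (∑ k, e (α k))).toFinset) hN
      (S.commute_pairOp_basisProj hψ (M := ∑ k, e (α k)) (by simp)) hX hQ hij σ (by simp)
  have h2 : star W * W = 1 :=
    Unitary.star_mul_self_of_mem (pairOp_mem_unitary i j hij.ne (S.unitary_U σ))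
  change X * W = W * X
  calc X * W = W * X * star W * W := by rw [h1]
    _ = W * X := by rw [mul_assoc, h2, mul_one]

/-- In the ergodic case, equilibrium states are diagonal in the product eigenbasis. -/
theorem inner_eq_zero_of_average_eq (hN : 2 ≤ N) (hS : S.IsErgodic)
    (hψ : ∀ j, ∃ hj : ψ j ∈ h.op.domain, h.op ⟨ψ j, hj⟩ = (e j : ℂ) • ψ j)
    (hfin : ∀ M : ℝ, {α : Fin N → J | ∑ k, e (α k) ≤ M}.Finite)
    {X : TensorPower H N →L[ℂ] TensorPower H N} (hX : IsSelfAdjoint X) (hQ : S.average N X = X)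
    {α β : Fin N → J} (hαβ : α ≠ β) : ⟪tensorBasis ψ N β, X (tensorBasis ψ N α)⟫_ℂ = 0 := by
  obtain ⟨k, hk⟩ := Function.ne_iff.1 hαβ
  -- As `N ≥ 2`, the slot `k` where `α` and `β` differ belongs to some pair.
  have : Nontrivial (Fin N) := Fin.nontrivial_iff_two_le.2 hN
  obtain ⟨l, hl⟩ := exists_ne k
  rcases lt_or_gt_of_ne hl with hlt | hlt
  · exact S.inner_eq_zero_of_commute_pairOp hS hψ hlt.ne
      (S.commute_of_average_eq hN hψ hfin hX hQ hlt) (Or.inr hk)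
  · exact S.inner_eq_zero_of_commute_pairOp hS hψ hlt.ne
      (S.commute_of_average_eq hN hψ hfin hX hQ hlt) (Or.inl hk)

end CollisionSpec

/-! ### Density matrices, their compressions and finite-dimensional corners -/

section Density

variable {K : Type*} [NormedAddCommGroup K] [InnerProductSpace ℂ K] [CompleteSpace K]

theorem isDensity_rankOne {v : K} (hv : ‖v‖ = 1) : IsDensity (InnerProductSpace.rankOne ℂ v v) := by
  refine ⟨InnerProductSpace.isPositive_rankOne_self v, ?_⟩
  have h1 : ∀ j, RCLike.re ⟪onb K j, InnerProductSpace.rankOne ℂ v v (onb K j)⟫_ℂ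
      = ‖⟪onb K j, v⟫_ℂ‖ ^ 2 := fun j => by
    rw [InnerProductSpace.rankOne_apply, inner_smul_right, ← inner_conj_symm, mul_comm,
      RCLike.mul_conj]
    exact_mod_cast Complex.ofReal_re _
  rw [posTrace]
  simp only [h1]
  rw [tsum_ofReal_norm_inner_sq, hv]
  simp

variable {ι : Type*} (b : HilbertBasis ι ℂ K)

theorem re_basisTrace_nonneg {A : K →L[ℂ] K} (hA : A.IsPositive) (F : Finset ι) :
    0 ≤ RCLike.re (basisTrace b F A) := by
  rw [basisTrace_apply, map_sum]
  exact Finset.sum_nonneg fun i _ => hA.re_inner_nonneg_right _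

theorem re_basisTrace_le_one {A : K →L[ℂ] K} (hA : IsDensity A) (F : Finset ι) :
    RCLike.re (basisTrace b F A) ≤ 1 := by
  have h1 := posTrace_eq_add b F hA.1
  rw [hA.2, posTrace_conj_basisProj b F hA.1] at h1
  have h2 : ENNReal.ofReal (RCLike.re (basisTrace b F A)) ≤ 1 := h1 ▸ le_self_add
  exact ENNReal.ofReal_le_one.1 h2

theorem posTrace_conj_compl {A : K →L[ℂ] K} (hA : IsDensity A) (F : Finset ι) :
    posTrace ((1 - basisProj b F) * A * (1 - basisProj b F))
      = ENNReal.ofReal (1 - RCLike.re (basisTrace b F A)) := by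
  have h1 := posTrace_eq_add b F hA.1
  rw [hA.2, posTrace_conj_basisProj b F hA.1] at h1
  rw [ENNReal.ofReal_sub _ (re_basisTrace_nonneg b hA.1 F), ENNReal.ofReal_one, h1]
  exact (ENNReal.add_sub_cancel_left ENNReal.ofReal_ne_top).symm

theorem posTrace_compressionBound_le {A : K →L[ℂ] K} (hA : IsDensity A) (F : Finset ι) {δ η : ℝ}
    (hδ : 0 < δ) (hF : 1 - η ≤ RCLike.re (basisTrace b F A)) :
    posTrace (compressionBound δ (basisProj b F) A) ≤ ENNReal.ofReal (δ + (1 + δ⁻¹) * η) := by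
  have hP := isSelfAdjoint_basisProj b F
  have h1 := re_basisTrace_le_one b hA F
  rw [compressionBound, posTrace_add (isPositive_smul (isPositive_conj hA.1 hP) hδ.le)
    (isPositive_smul (isPositive_conj hA.1 ((IsSelfAdjoint.one _).sub hP)) (by positivity)),
    posTrace_smul hδ.le, posTrace_smul (by positivity), posTrace_conj_basisProj b F hA.1,
    posTrace_conj_compl b hA, ← ENNReal.ofReal_mul hδ.le, ← ENNReal.ofReal_mul (by positivity),
    ← ENNReal.ofReal_add (mul_nonneg hδ.le (re_basisTrace_nonneg b hA.1 F))
      (mul_nonneg (by positivity) (by linarith))]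
  refine ENNReal.ofReal_le_ofReal (add_le_add ?_ ?_)
  · exact mul_le_of_le_one_right hδ.le h1
  · exact mul_le_mul_of_nonneg_left (by linarith) (by positivity)

/-- `δ` is fixed first and `η` is then chosen small relative to `1 + δ⁻¹`; the total is `3ε/4`. -/
theorem exists_compression_parameters {ε : ℝ} (hε : 0 < ε) :
    ∃ δ η : ℝ, 0 < δ ∧ 0 < η ∧ δ + (1 + δ⁻¹) * η < ε := by
  refine ⟨ε / 2, ε / 4 / (1 + (ε / 2)⁻¹), by positivity, by positivity, ?_⟩
  rw [mul_div_cancel₀ _ (by positivity)]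
  linarith

theorem norm_sub_conj_basisProj_le {A : K →L[ℂ] K} (hA : IsDensity A) (F : Finset ι) {δ η : ℝ}
    (hδ : 0 < δ) (hη : 0 < η) (hF : 1 - η ≤ RCLike.re (basisTrace b F A)) :
    ‖A - basisProj b F * A * basisProj b F‖ ≤ δ + (1 + δ⁻¹) * η := by
  have hP := isSelfAdjoint_basisProj b F
  refine norm_le_of_abs_re_inner_le
    (hA.1.isSelfAdjoint.sub (isPositive_conj hA.1 hP).isSelfAdjoint) (by positivity) fun v => ?_
  exact (abs_re_inner_sub_conj_le hδ hA.1 hP v).trans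
    (re_inner_le_of_posTrace_le (isPositive_compressionBound hδ hA.1 hP) (by positivity)
      (posTrace_compressionBound_le b hA F hδ hF) v)

/-- Traces of positive operators are determined by arbitrarily large partial traces. -/
theorem posTrace_le_of_basisTrace_eq {A B : K →L[ℂ] K} (hA : A.IsPositive) (hB : B.IsPositive)
    (h : ∀ F₀ : Finset ι, ∃ F, F₀ ⊆ F ∧ basisTrace b F A = basisTrace b F B) :
    posTrace A ≤ posTrace B := by
  rw [posTrace_eq b hA, posTrace_eq b hB, ENNReal.tsum_eq_iSup_sum]
  refine iSup_le fun F₀ => ?_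
  obtain ⟨F, hF, hAB⟩ := h F₀
  refine (Finset.sum_le_sum_of_subset hF).trans (le_trans (le_of_eq ?_) (ENNReal.sum_le_tsum F))
  rw [← ENNReal.ofReal_sum_of_nonneg fun i _ => hA.re_inner_nonneg_right _,
    ← ENNReal.ofReal_sum_of_nonneg fun i _ => hB.re_inner_nonneg_right _, ← map_sum, ← map_sum,
    ← basisTrace_apply, ← basisTrace_apply, hAB]

theorem isDensity_of_basisTrace_eq {A B : K →L[ℂ] K} (hA : A.IsPositive) (hB : IsDensity B)
    (h : ∀ F₀ : Finset ι, ∃ F, F₀ ⊆ F ∧ basisTrace b F A = basisTrace b F B) : IsDensity A := by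
  refine ⟨hA, le_antisymm ?_ ?_⟩
  · exact (posTrace_le_of_basisTrace_eq b hA hB.1 h).trans_eq hB.2
  · rw [← hB.2]
    refine posTrace_le_of_basisTrace_eq b hB.1 hA fun F₀ => ?_
    obtain ⟨F, hF, hAB⟩ := h F₀
    exact ⟨F, hF, hAB.symm⟩

/-- The operators supported in the span of finitely many basis vectors. -/
def cornerSpan (F : Finset ι) : Submodule ℂ (K →L[ℂ] K) :=
  Submodule.span ℂ (Set.range fun p : F × F => InnerProductSpace.rankOne ℂ (b p.1) (b p.2))

instance finiteDimensional_cornerSpan (F : Finset ι) : FiniteDimensional ℂ (cornerSpan b F) :=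
  FiniteDimensional.span_of_finite ℂ (Set.finite_range _)

theorem conj_mem_cornerSpan (A : K →L[ℂ] K) (F : Finset ι) :
    basisProj b F * A * basisProj b F ∈ cornerSpan b F := by
  have h1 : basisProj b F * A * basisProj b F = ∑ j ∈ F, ∑ i ∈ F,
      ⟪b i, A (b j)⟫_ℂ • InnerProductSpace.rankOne ℂ (b i) (b j) := by
    ext1 x
    rw [mul_apply_eq_comp, mul_apply_eq_comp, basisProj_apply b F x, map_sum, map_sum, sum_apply]
    refine Finset.sum_congr rfl fun j _ => ?_
    rw [map_smul, map_smul, basisProj_apply, sum_apply, Finset.smul_sum]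
    refine Finset.sum_congr rfl fun i _ => ?_
    rw [smul_apply, InnerProductSpace.rankOne_apply, smul_comm]
  rw [h1]
  exact Submodule.sum_mem _ fun j hj => Submodule.sum_mem _ fun i hi =>
    Submodule.smul_mem _ _ (Submodule.subset_span ⟨(⟨i, hi⟩, ⟨j, hj⟩), rfl⟩)

theorem conj_eq_of_mem_cornerSpan {F : Finset ι} {A : K →L[ℂ] K} (hA : A ∈ cornerSpan b F) :
    basisProj b F * A * basisProj b F = A := by
  induction hA using Submodule.span_induction with
  | mem x hx =>
    obtain ⟨⟨i, j⟩, rfl⟩ := hx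
    ext1 x
    rw [mul_apply_eq_comp, mul_apply_eq_comp, InnerProductSpace.rankOne_apply,
      InnerProductSpace.rankOne_apply, ← inner_selfAdjoint (isSelfAdjoint_basisProj b F),
      basisProj_basis_of_mem b F j.2, map_smul, basisProj_basis_of_mem b F i.2]
  | zero => simp
  | add x y _ _ hx hy => rw [mul_add, add_mul, hx, hy]
  | smul c x _ hx => rw [mul_smul_comm, smul_mul_assoc, hx]

end Density

/-! ### Separability of diagonal density matrices -/

section Separability

variable {H : Type*} [NormedAddCommGroup H] [InnerProductSpace ℂ H] [CompleteSpace H]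
  {J : Type*} (ψ : HilbertBasis J ℂ H) {N : ℕ}

theorem rankOne_tensorBasis_mem_productStates (α : Fin N → J) :
    InnerProductSpace.rankOne ℂ (tensorBasis ψ N α) (tensorBasis ψ N α) ∈ productStates H N := by
  refine ⟨isDensity_rankOne ((tensorBasis ψ N).orthonormal.1 α),
    fun k => InnerProductSpace.rankOne ℂ (ψ (α k)) (ψ (α k)),
    fun k => isDensity_rankOne (ψ.orthonormal.1 _), fun φ => ?_⟩
  simp only [InnerProductSpace.rankOne_apply, tensorBasis_apply, productVector_smul,
    inner_productVector]

/-- A density matrix which is diagonal in a product basis is separable. -/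
theorem isSeparable_of_diagonal {ϱ : TensorPower H N →L[ℂ] TensorPower H N} (hϱ : IsDensity ϱ)
    (hd : ∀ α β : Fin N → J, α ≠ β → ⟪tensorBasis ψ N β, ϱ (tensorBasis ψ N α)⟫_ℂ = 0) :
    IsSeparable ϱ := by
  refine ⟨hϱ, fun ε hε => ?_⟩
  obtain ⟨r, -, hr, hrε⟩ := ENNReal.lt_iff_exists_real_btwn.1 hε
  have hr0 : 0 < r := ENNReal.ofReal_pos.1 hr
  set b := tensorBasis ψ N with hb
  -- The bound `1` makes the retained mass `s` positive, so that normalising is possible. The bound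
  -- `r/2` serves the final distance estimate `2 (1 - s) < r`.
  obtain ⟨F, hF⟩ := exists_finset_lt_basisTrace b hϱ (ε := min (r / 2) 1) (by positivity)
  have hs1 := hF F subset_rfl
  set s := RCLike.re (basisTrace b F ϱ) with hs
  have hs0 : 0 < s := by linarith [min_le_right (r / 2) 1]
  have hsle : s ≤ 1 := re_basisTrace_le_one b hϱ F
  have hP := isSelfAdjoint_basisProj b F
  set P := basisProj b F with hPdef
  let lam : (Fin N → J) → ℝ := fun α => RCLike.re ⟪b α, ϱ (b α)⟫_ℂ
  have hlam : ∀ α, ϱ (b α) = (lam α : ℂ) • b α := fun α => by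
    refine ext_inner_hilbertBasis b fun β => ?_
    rw [inner_smul_right]
    by_cases hβ : α = β
    · subst hβ
      rw [inner_self_eq_norm_sq_to_K, b.orthonormal.1 α]
      have h1 : (lam α : ℂ) = ⟪b α, ϱ (b α)⟫_ℂ := by
        refine Complex.conj_eq_iff_re.1 ?_
        rw [inner_conj_symm, inner_selfAdjoint hϱ.1.isSelfAdjoint]
      rw [h1]
      simp
    · rw [hd α β hβ, b.orthonormal.2 (Ne.symm hβ), mul_zero]
  have hsum : ∑ α ∈ F, lam α = s := by rw [hs, basisTrace_apply, map_sum]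
  have hPP : P * ϱ * P = ∑ α ∈ F, (lam α : ℂ) • InnerProductSpace.rankOne ℂ (b α) (b α) := by
    ext1 x
    rw [mul_apply_eq_comp, mul_apply_eq_comp, hPdef, basisProj_apply b F x, map_sum, map_sum,
      sum_apply]
    refine Finset.sum_congr rfl fun α hα => ?_
    rw [map_smul, hlam, map_smul, map_smul, basisProj_basis_of_mem b F hα, smul_apply,
      InnerProductSpace.rankOne_apply, smul_comm]
  have hdec : ϱ = P * ϱ * P + (1 - P) * ϱ * (1 - P) := by
    refine ext_hilbertBasis b fun α => ?_
    by_cases hα : α ∈ F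
    · simp only [add_apply, mul_apply_eq_comp, sub_apply, one_apply_eq_self, hPdef,
        basisProj_basis_of_mem b F hα, hlam, map_smul, sub_self, map_zero, add_zero]
    · simp only [add_apply, mul_apply_eq_comp, sub_apply, one_apply_eq_self, hPdef,
        basisProj_basis_of_notMem b F hα, hlam, map_smul, map_zero, sub_zero, zero_add]
  -- The witness is the truncation to `F` normalised to trace one. The discarded tail and the
  -- renormalisation each cost `1 - s` in trace norm.
  refine ⟨F.centerMass lam fun α => InnerProductSpace.rankOne ℂ (b α) (b α),
    Finset.centerMass_mem_convexHull F (fun α _ => hϱ.1.re_inner_nonneg_right _)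
      (by rw [hsum]; exact hs0) fun α _ => rankOne_tensorBasis_mem_productStates ψ α, ?_⟩
  have hω : (F.centerMass lam fun α => InnerProductSpace.rankOne ℂ (b α) (b α))
      = ((s⁻¹ : ℝ) : ℂ) • (P * ϱ * P) := by
    rw [Finset.centerMass, hsum, hPP]
    rfl
  have hs2 : 0 ≤ s⁻¹ - 1 := sub_nonneg.2 ((one_le_inv₀ hs0).2 hsle)
  have hG1 : ((1 - P) * ϱ * (1 - P)).IsPositive :=
    isPositive_conj hϱ.1 ((IsSelfAdjoint.one _).sub hP)
  have hG2 : (((s⁻¹ - 1 : ℝ) : ℂ) • (P * ϱ * P)).IsPositive :=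
    isPositive_smul (isPositive_conj hϱ.1 hP) hs2
  have hdiff : ϱ - ((s⁻¹ : ℝ) : ℂ) • (P * ϱ * P)
      = (1 - P) * ϱ * (1 - P) - ((s⁻¹ - 1 : ℝ) : ℂ) • (P * ϱ * P) := by
    nth_rewrite 1 [hdec]
    push_cast
    module
  rw [hω, hdiff]
  refine (traceNorm_le_posTrace (hG1.isSelfAdjoint.sub hG2.isSelfAdjoint) (hG1.add hG2)
    fun v => ?_).trans_lt ?_
  · rw [sub_apply, add_apply, inner_sub_right, inner_add_right, map_sub, map_add]
    have h1 := hG1.re_inner_nonneg_right v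
    have h2 := hG2.re_inner_nonneg_right v
    rw [abs_le]
    constructor <;> linarith
  · rw [posTrace_add hG1 hG2, posTrace_smul hs2, posTrace_conj_basisProj b F hϱ.1,
      posTrace_conj_compl b hϱ, ← hs, ← ENNReal.ofReal_mul hs2, ← ENNReal.ofReal_add (by linarith)
      (mul_nonneg hs2 hs0.le), sub_mul, inv_mul_cancel₀ hs0.ne', one_mul]
    refine lt_of_le_of_lt (ENNReal.ofReal_le_ofReal ?_) hrε
    linarith [min_le_left (r / 2) 1]

end Separability

/-! ### Convergence to equilibrium in trace norm -/

section TraceNormConvergence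

variable {K : Type*} [NormedAddCommGroup K] [InnerProductSpace ℂ K] [CompleteSpace K]
  {ι : Type*} (b : HilbertBasis ι ℂ K)

/-- Two density matrices which have most of their mass in the span of `F` are as close in trace
norm as they are in operator norm. -/
theorem traceNorm_sub_le {A B : K →L[ℂ] K} (hA : IsDensity A) (hB : IsDensity B) (F : Finset ι)
    {δ η : ℝ} (hδ : 0 < δ) (hη : 0 < η) (hFA : 1 - η ≤ RCLike.re (basisTrace b F A))
    (hFB : 1 - η ≤ RCLike.re (basisTrace b F B)) :
    traceNorm (A - B) ≤ ENNReal.ofReal (2 * (δ + (1 + δ⁻¹) * η) + ‖A - B‖ * F.card) := by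
  have hP := isSelfAdjoint_basisProj b F
  set P := basisProj b F with hPdef
  have hPP : P * P = P := basisProj_mul_self b F
  have hPpos : P.IsPositive := by
    have h1 := isPositive_conj (ContinuousLinearMap.isPositive_one (E := K) (𝕜 := ℂ)) hP
    rwa [mul_one, hPP] at h1
  have hGA := isPositive_compressionBound hδ hA.1 hP
  have hGB := isPositive_compressionBound hδ hB.1 hP
  have hGP := isPositive_smul hPpos (norm_nonneg (A - B))
  refine (traceNorm_le_posTrace (hA.1.isSelfAdjoint.sub hB.1.isSelfAdjoint)
    ((hGA.add hGB).add hGP) fun v => ?_).trans ?_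
  · have h1 := abs_re_inner_sub_conj_le hδ hA.1 hP v
    have h2 := abs_re_inner_sub_conj_le hδ hB.1 hP v
    have h3 : |RCLike.re ⟪v, (P * (A - B) * P) v⟫_ℂ|
        ≤ RCLike.re ⟪v, (((‖A - B‖ : ℝ) : ℂ) • P) v⟫_ℂ := by
      have h4 : RCLike.re ⟪v, (((‖A - B‖ : ℝ) : ℂ) • P) v⟫_ℂ = ‖A - B‖ * ‖P v‖ ^ 2 := by
        rw [smul_apply, inner_smul_right]
        refine (Complex.re_ofReal_mul _ _).trans ?_
        rw [← inner_self_eq_norm_sq (𝕜 := ℂ), inner_selfAdjoint hP, ← mul_apply_eq_comp, hPP]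
        rfl
      rw [re_inner_conj hP, h4]
      refine (RCLike.abs_re_le_norm _).trans ((norm_inner_le_norm _ _).trans ?_)
      have h5 := (A - B).le_opNorm (P v)
      nlinarith [norm_nonneg (P v)]
    -- Two compression errors and a finite-rank remainder; the latter is bounded in quadratic form
    -- by `‖A - B‖ P`, whose trace is `‖A - B‖` times the cardinality of `F`.
    have h6 : RCLike.re ⟪v, (A - B) v⟫_ℂ = RCLike.re ⟪v, (A - P * A * P) v⟫_ℂ
        - RCLike.re ⟪v, (B - P * B * P) v⟫_ℂ + RCLike.re ⟪v, (P * (A - B) * P) v⟫_ℂ := by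
      rw [← map_sub, ← map_add, ← inner_sub_right, ← inner_add_right, ← sub_apply, ← add_apply]
      congr 4
      noncomm_ring
    rw [h6, add_apply, add_apply, inner_add_right, inner_add_right, map_add, map_add]
    rw [abs_le] at *
    constructor <;> linarith
  · rw [posTrace_add (hGA.add hGB) hGP, posTrace_add hGA hGB, posTrace_smul (norm_nonneg _),
      posTrace_basisProj, ENNReal.ofReal_add (by positivity) (by positivity), two_mul,
      ENNReal.ofReal_add (by positivity) (by positivity), ENNReal.ofReal_mul (norm_nonneg _),
      ENNReal.ofReal_natCast]
    gcongr
    · exact posTrace_compressionBound_le b hA F hδ hFA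
    · exact posTrace_compressionBound_le b hB F hδ hFB

end TraceNormConvergence

namespace CollisionSpec

variable {H : Type*} [NormedAddCommGroup H] [InnerProductSpace ℂ H] [CompleteSpace H]
  {h : Hamiltonian H} {C : Type*} [MetricSpace C] [CompactSpace C] [MeasurableSpace C]
  [BorelSpace C] (S : CollisionSpec h C) {N : ℕ}

theorem generator_eq_zero_iff (hN : 2 ≤ N) (A : TensorPower H N →L[ℂ] TensorPower H N) :
    S.generator N A = 0 ↔ S.average N A = A := by
  have h0 : (N : ℂ) ≠ 0 := by exact_mod_cast (by omega : N ≠ 0)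
  change (N : ℂ) • (S.average N A - A) = 0 ↔ _
  rw [smul_eq_zero_iff_right h0, sub_eq_zero]

theorem evolution_eq (t : ℝ) : S.evolution N t = expSemigroup (S.average N - 1) (t * N) := by
  rw [evolution, expSemigroup, expSemigroup, generator, smul_smul]
  push_cast
  rfl

theorem isPositive_evolution {A : TensorPower H N →L[ℂ] TensorPower H N} (hA : A.IsPositive) {t : ℝ}
    (ht : 0 ≤ t) : (S.evolution N t A).IsPositive := by
  rw [evolution_eq, ← ContinuousLinearMap.nonneg_iff_isPositive]
  have hmem := fun B : TensorPower H N →L[ℂ] TensorPower H N =>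
    Set.mem_Ici.trans (ContinuousLinearMap.nonneg_iff_isPositive B)
  exact Set.mem_Ici.1 <| expSemigroup_mem (P := Set.Ici 0) isClosed_Ici Set.self_mem_Ici
    (fun x hx y hy => (hmem _).2 (((hmem x).1 hx).add ((hmem y).1 hy)))
    (fun c hc x hx => (hmem _).2 (isPositive_smul ((hmem x).1 hx) hc))
    (fun x hx => (hmem _).2 (S.isPositive_average ((hmem x).1 hx))) (by positivity) ((hmem A).2 hA)

variable {ι : Type*} (b : HilbertBasis ι ℂ (TensorPower H N))

/-- If there are arbitrarily large finite sets of basis vectors whose spans are invariant under the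
collisions, then each density matrix converges to an equilibrium, in trace norm. -/
theorem exists_tendsto_evolution (hN : 2 ≤ N)
    (hex : ∀ F₀ : Finset ι, ∃ F, F₀ ⊆ F ∧
      ∀ i j hij σ, Commute (pairOp i j hij (S.U σ)) (basisProj b F))
    {ϱ₀ : TensorPower H N →L[ℂ] TensorPower H N} (hϱ₀ : IsDensity ϱ₀) :
    ∃ ϱ : TensorPower H N →L[ℂ] TensorPower H N, IsDensity ϱ ∧ S.average N ϱ = ϱ ∧
      Tendsto (fun t : ℝ => traceNorm (S.evolution N t ϱ₀ - ϱ)) atTop (𝓝 0) := by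
  have hQ := S.norm_average_le hN
  -- The finite-dimensional invariant subspaces are the corners of the projections that commute with
  -- the collisions, and the approximants are the compressions of `ϱ₀`.
  obtain ⟨ϱ, hfix, hs⟩ := exists_tendsto_expSemigroup (x := ϱ₀) hQ fun ε hε => by
    obtain ⟨δ, η, hδ, hη, hδη⟩ := exists_compression_parameters hε
    obtain ⟨F₀, hF₀⟩ := exists_finset_lt_basisTrace b hϱ₀ hη
    obtain ⟨F, hF, hcomm⟩ := hex F₀
    refine ⟨cornerSpan b F, inferInstance, fun y hy => ?_, _, conj_mem_cornerSpan b ϱ₀ F,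
      (norm_sub_conj_basisProj_le b hϱ₀ F hδ hη (hF₀ F hF).le).trans_lt hδη⟩
    rw [← conj_eq_of_mem_cornerSpan b hy, S.average_conj hcomm (isSelfAdjoint_basisProj b F)]
    exact conj_mem_cornerSpan b _ F
  have hN0 : (0 : ℝ) < N := by exact_mod_cast (by omega : 0 < N)
  have ht : Tendsto (fun t : ℝ => S.evolution N t ϱ₀) atTop (𝓝 ϱ) := by
    simp only [evolution_eq]
    exact hs.comp (tendsto_id.atTop_mul_const hN0)
  -- Conserved partial traces: no mass escapes, at finite times or in the limit. One set `F` then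
  -- captures most of the mass uniformly in time.
  have htr : ∀ F, (∀ i j hij σ, Commute (pairOp i j hij (S.U σ)) (basisProj b F)) → ∀ t,
      basisTrace b F (S.evolution N t ϱ₀) = basisTrace b F ϱ₀ := fun F hF t => by
    rw [evolution_eq]
    exact map_expSemigroup (basisTrace b F) (S.basisTrace_average b hN hF) _ _
  have htr' : ∀ F, (∀ i j hij σ, Commute (pairOp i j hij (S.U σ)) (basisProj b F)) →
      basisTrace b F ϱ = basisTrace b F ϱ₀ := fun F hF => by
    have h1 := ((basisTrace b F).continuous.tendsto ϱ).comp ht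
    simp only [Function.comp_def, htr F hF] at h1
    exact tendsto_nhds_unique h1 tendsto_const_nhds
  have hdt : ∀ t, 0 ≤ t → IsDensity (S.evolution N t ϱ₀) := fun t ht0 =>
    isDensity_of_basisTrace_eq b (S.isPositive_evolution hϱ₀.1 ht0) hϱ₀ fun F₀ => by
      obtain ⟨F, hF, hcomm⟩ := hex F₀
      exact ⟨F, hF, htr F hcomm t⟩
  have hpos : ϱ.IsPositive := by
    rw [← ContinuousLinearMap.nonneg_iff_isPositive]
    refine ge_of_tendsto ht ?_
    filter_upwards [eventually_ge_atTop 0] with t ht0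
    exact (ContinuousLinearMap.nonneg_iff_isPositive _).2 (S.isPositive_evolution hϱ₀.1 ht0)
  have hd : IsDensity ϱ := isDensity_of_basisTrace_eq b hpos hϱ₀ fun F₀ => by
    obtain ⟨F, hF, hcomm⟩ := hex F₀
    exact ⟨F, hF, htr' F hcomm⟩
  refine ⟨ϱ, hd, hfix, ?_⟩
  rw [ENNReal.tendsto_nhds_zero]
  intro ε hε
  obtain ⟨r, -, hr, hrε⟩ := ENNReal.lt_iff_exists_real_btwn.1 hε
  have hr0 : 0 < r := ENNReal.ofReal_pos.1 hr
  -- The final error is less than `2 · (r/4)` from the two compressions plus `r/2` from the operator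
  -- norm on the span of `F`.
  obtain ⟨δ, η, hδ, hη, hδη⟩ := exists_compression_parameters (ε := r / 4) (by positivity)
  obtain ⟨F₀, hF₀⟩ := exists_finset_lt_basisTrace b hϱ₀ hη
  obtain ⟨F, hF, hcomm⟩ := hex F₀
  have h1 : Tendsto (fun t : ℝ => ‖S.evolution N t ϱ₀ - ϱ‖ * F.card) atTop (𝓝 0) := by
    simpa using (tendsto_iff_norm_sub_tendsto_zero.1 ht).mul_const (F.card : ℝ)
  filter_upwards [h1.eventually_lt_const (by positivity : (0 : ℝ) < r / 2),
    eventually_ge_atTop 0] with t ht1 ht0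
  refine (traceNorm_sub_le b (hdt t ht0) hd F hδ hη ?_ ?_).trans
    ((ENNReal.ofReal_le_ofReal ?_).trans hrε.le)
  · rw [htr F hcomm]
    exact (hF₀ F hF).le
  · rw [htr' F hcomm]
    exact (hF₀ F hF).le
  · linarith

end CollisionSpec

end QuantumKac

end

theorem corollary2p17 {H : Type*} [NormedAddCommGroup H] [InnerProductSpace ℂ H] [CompleteSpace H]
    [TopologicalSpace.SeparableSpace H]
    {C : Type*} [MetricSpace C] [CompactSpace C] [MeasurableSpace C] [BorelSpace C]
    (h : QuantumKac.Hamiltonian H) (S : QuantumKac.CollisionSpec h C) (hS : S.IsErgodic)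
    (N : ℕ) (hN : 2 ≤ N) :
    (∀ ϱ : QuantumKac.TensorPower H N →L[ℂ] QuantumKac.TensorPower H N,
      QuantumKac.IsDensity ϱ → S.generator N ϱ = 0 → QuantumKac.IsSeparable ϱ) ∧
    (∀ ϱ₀ : QuantumKac.TensorPower H N →L[ℂ] QuantumKac.TensorPower H N,
      QuantumKac.IsDensity ϱ₀ →
        ∃ ϱ : QuantumKac.TensorPower H N →L[ℂ] QuantumKac.TensorPower H N,
          QuantumKac.IsDensity ϱ ∧ S.generator N ϱ = 0 ∧ QuantumKac.IsSeparable ϱ ∧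
          Tendsto (fun t : ℝ => QuantumKac.traceNorm (S.evolution N t ϱ₀ - ϱ)) atTop (𝓝 0)) := by
  obtain ⟨J, ψ, e, hψ, ⟨c, hc⟩, he⟩ := h.exists_eigenbasis
  have hfin := QuantumKac.CollisionSpec.finite_energy_le hc he N
  have hsep : ∀ ϱ : QuantumKac.TensorPower H N →L[ℂ] QuantumKac.TensorPower H N,
      QuantumKac.IsDensity ϱ → S.generator N ϱ = 0 → QuantumKac.IsSeparable ϱ := fun ϱ hϱ hL =>
    QuantumKac.isSeparable_of_diagonal ψ hϱ fun α β hαβ =>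
      S.inner_eq_zero_of_average_eq hN hS hψ hfin hϱ.1.isSelfAdjoint
        ((S.generator_eq_zero_iff hN ϱ).1 hL) hαβ
  refine ⟨hsep, fun ϱ₀ hϱ₀ => ?_⟩
  obtain ⟨ϱ, hϱ, hfix, hlim⟩ := S.exists_tendsto_evolution (QuantumKac.tensorBasis ψ N) hN
    (fun F₀ => by
      -- A level above all energies in `F₀`; all multi-indices up to this level form a finite set
      -- containing `F₀`, whose span is invariant under collisions.
      obtain ⟨M, hM⟩ := (F₀.image fun α => ∑ k, e (α k)).exists_le
      refine ⟨(hfin M).toFinset, fun α hα => ?_, fun i j hij σ =>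
        S.commute_pairOp_basisProj hψ (M := M) (by simp) i j hij σ⟩
      simpa using hM _ (Finset.mem_image_of_mem _ hα)) hϱ₀
  have hL := (S.generator_eq_zero_iff hN ϱ).2 hfix
  exact ⟨ϱ, hϱ, hL, hsep ϱ hϱ hL, hlim⟩
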